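/- Let $p$ be a prime and let $k$ be an algebraically closed field of characteristic $p$. Write $k(z)=k(z_1,z_2,\ldots)$ and let $$\mathcal R=\bigoplus_{\rho\in k}t^\rho\, k(z)((x))$$ be the group algebra of the additive group of $k$ over $k(z)((x))$, so $t^\rho t^\sigma=t^{\rho+\sigma}$. It carries the derivation $\partial$, which is zero on $k$ and acts termwise on Laurent series, with $\partial x=1$, $\partial t^\rho=\rho\, t^\rho x^{-1}$, $\partial z_1=x^{-1}$ and $\partial z_{i+1}=(x z_1\cdots z_i)^{-1}$. Let $\mathcal C=\{c\in\mathcal R:\partial c=0\}$ be the ring of constants; it is a field. Let $L=\sum_{j=0}^n p_j\partial^j=\sum_{i,j}c_{ij}x^i\partial^j\in k[[x]][\partial]$, of order $n$ (so $p_n\neq0$), acting on $\mathcal R$. Let $\tau=\min\{i-j: c_{ij}\ne0\}$ be its shift and $\sum_{i-j=\tau}c_{ij}x^i\partial^j$ its initial form. Assume that $L$ has a regular singularity at $0$, that is, its initial form again has order $n$ (ordinary points are allowed). Let $M=x^{-\tau}L$, with initial form $L_0=\sum_j c_{j+\tau,j}\,x^j\partial^j$ (where $c_{ij}=0$ for $i<0$).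 The local exponents of $L$ are the roots $\rho\in k$ of the indicial polynomial $\chi(s)=\sum_j c_{j+\tau,j}\,s(s-1)\cdots(s-j+1)$, and $m_\rho$ is the multiplicity of $\rho$ as a root of $\chi$ (zero if $\rho$ is not a root). For a local exponent $\rho$ put $\xi(m)=m_\rho+m_{\rho+1}+\cdots+m_{\rho+m}$ for $m\ge 0$, let $\mathcal A_m$ be the set of finitely supported sequences $\alpha=(\alpha_1,\alpha_2,\ldots)$ of natural numbers with $\alpha_1<\xi(m)$ and $\alpha_{j+1}\le\alpha_j/p$ for all $j\geq 1$, and put $e(\alpha)=\sum_{j\ge1}p^{j-1}\overline{\alpha_j}$, where $\overline{a}\in\{0,\ldots,p-1\}$ is the remainder of $a$ modulo $p$. Let $$\mathcal F^\rho=t^\rho\sum_{m\ge0}\Big(\bigoplus_{\alpha\in\mathcal A_m}k z^\alpha\Big)x^m,\qquad \mathcal H^\rho=t^\rho\sum_{m\ge0}\Big(\bigoplus_{\alpha\in\mathcal A_m,\ e(\alpha)\ge m_{\rho+m}}k z^\alpha\Big)x^m$$ (infinite sums over $m$ allowed). Then $L_0$ restricts to a bijection $\mathcal H^\rho\to\mathcal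 F^\rho x$; let $S:\mathcal F^\rho x\to\mathcal H^\rho\subseteq\mathcal F^\rho$ be its inverse. The operator $T=L_0-M$ maps $\mathcal F^\rho$ into $\mathcal F^\rho x$, and $u_\rho=\mathrm{Id}-S\circ T$ is a bijection of $\mathcal F^\rho$ onto itself. **Theorem.** The solutions of $Ly=0$ in $\mathcal R$ form an $n$-dimensional vector space over the field $\mathcal C$. A basis is given by $$y_{\rho,i}=u_\rho^{-1}\big(t^\rho z^{i^*}\big),\qquad i^*=(i,\lfloor i/p\rfloor,\lfloor i/p^2\rfloor,\ldots),$$ where $\rho$ runs over the local exponents of $L$ and $0\le i<m_\rho$; the elements $t^\rho z^{i^*}$ lie in $\mathcal F^\rho$. -/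

import Mathlib

noncomputable section
namespace EulerPrimitive

/-- The quotient rule does not depend on the representation of a fraction. -/
theorem fracDerivFun_eq {k A F : Type*} [Field k] [CommRing A] [IsDomain A] [Algebra k A]
    [Field F] [Algebra A F] [IsFractionRing A F] [Algebra k F] (d : Derivation k A F)
    {a b a' b' : A} (hb : b ≠ 0) (hb' : b' ≠ 0)
    (h : algebraMap A F a / algebraMap A F b = algebraMap A F a' / algebraMap A F b') :
    (algebraMap A F b * d a - algebraMap A F a * d b) / algebraMap A F b ^ 2 =
      (algebraMap A F b' * d a' - algebraMap A F a' * d b') / algebraMap A F b' ^ 2 := by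
  have i1 : algebraMap A F b ≠ 0 := by simpa using hb
  have i2 : algebraMap A F b' ≠ 0 := by simpa using hb'
  rw [div_eq_div_iff i1 i2] at h
  have h2 : a * b' = a' * b := by
    apply IsFractionRing.injective A F
    simpa using h
  have h3 := congrArg d h2
  simp only [Derivation.leibniz, Algebra.smul_def] at h3
  rw [div_eq_div_iff (pow_ne_zero _ i1) (pow_ne_zero _ i2)]
  linear_combination (algebraMap A F b * algebraMap A F b') * h3 -
    (algebraMap A F b' * d b + algebraMap A F b * d b') * h

/-- The extension of a derivation from a domain `A` to its fraction field `F` by the quotient rule. -/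
def fracDeriv {k A F : Type*} [Field k] [CommRing A] [IsDomain A] [Algebra k A]
    [Field F] [Algebra A F] [IsFractionRing A F] [Algebra k F] [IsScalarTower k A F]
    (d : Derivation k A F) : Derivation k F F :=
  let num : F → A := fun f => (IsFractionRing.div_surjective A f).choose
  let den : F → A := fun f => (IsFractionRing.div_surjective A f).choose_spec.choose
  have hden : ∀ f, den f ≠ 0 := fun f =>
    nonZeroDivisors.ne_zero (IsFractionRing.div_surjective A f).choose_spec.choose_spec.1
  have hfrac : ∀ f, algebraMap A F (num f) / algebraMap A F (den f) = f := fun f =>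
    (IsFractionRing.div_surjective A f).choose_spec.choose_spec.2
  let D : F → F := fun f =>
    (algebraMap A F (den f) * d (num f) - algebraMap A F (num f) * d (den f)) /
      algebraMap A F (den f) ^ 2
  have hD : ∀ (a b : A), b ≠ 0 → D (algebraMap A F a / algebraMap A F b) =
      (algebraMap A F b * d a - algebraMap A F a * d b) / algebraMap A F b ^ 2 :=
    fun a b hb => fracDerivFun_eq d (hden _) hb (hfrac _)
  have key : ∀ f : F, ∃ a b : A, b ≠ 0 ∧ f = algebraMap A F a / algebraMap A F b := fun f =>
    ⟨num f, den f, hden f, (hfrac f).symm⟩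
  Derivation.mk'
    { toFun := D
      map_add' := by
        intro f g
        obtain ⟨a, b, hb, rfl⟩ := key f
        obtain ⟨a', b', hb', rfl⟩ := key g
        have i1 : algebraMap A F b ≠ 0 := by simpa using hb
        have i2 : algebraMap A F b' ≠ 0 := by simpa using hb'
        have e : algebraMap A F a / algebraMap A F b + algebraMap A F a' / algebraMap A F b' =
            algebraMap A F (a * b' + b * a') / algebraMap A F (b * b') := by
          rw [div_add_div _ _ i1 i2]; simp
        rw [e, hD _ _ hb, hD _ _ hb', hD _ _ (mul_ne_zero hb hb')]
        simp only [map_add, map_mul, Derivation.leibniz, Algebra.smul_def]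
        field_simp
        ring
      map_smul' := by
        intro c f
        obtain ⟨a, b, hb, rfl⟩ := key f
        have i1 : algebraMap A F b ≠ 0 := by simpa using hb
        have e : c • (algebraMap A F a / algebraMap A F b) =
            algebraMap A F (c • a) / algebraMap A F b := by
          rw [Algebra.smul_def, Algebra.smul_def, map_mul, ← IsScalarTower.algebraMap_apply]
          ring
        rw [e, hD _ _ hb, hD _ _ hb]
        rw [Derivation.map_smul]
        simp only [Algebra.smul_def, map_mul, ← IsScalarTower.algebraMap_apply,
          RingHom.id_apply]
        ring }
    (by
      intro f g
      obtain ⟨a, b, hb, rfl⟩ := key f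
      obtain ⟨a', b', hb', rfl⟩ := key g
      have i1 : algebraMap A F b ≠ 0 := by simpa using hb
      have i2 : algebraMap A F b' ≠ 0 := by simpa using hb'
      have e : algebraMap A F a / algebraMap A F b * (algebraMap A F a' / algebraMap A F b') =
          algebraMap A F (a * a') / algebraMap A F (b * b') := by
        rw [div_mul_div_comm]; simp
      simp only [LinearMap.coe_mk, AddHom.coe_mk]
      rw [e, hD _ _ hb, hD _ _ hb', hD _ _ (mul_ne_zero hb hb')]
      simp only [map_mul, Derivation.leibniz, smul_eq_mul]
      simp only [Algebra.smul_def]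
      field_simp
      ring)

theorem fracDeriv_algebraMap {k A F : Type*} [Field k] [CommRing A] [IsDomain A] [Algebra k A]
    [Field F] [Algebra A F] [IsFractionRing A F] [Algebra k F] [IsScalarTower k A F]
    (d : Derivation k A F) (a : A) : fracDeriv d (algebraMap A F a) = d a := by
  have h := fracDerivFun_eq d
    (nonZeroDivisors.ne_zero (IsFractionRing.div_surjective A
      (algebraMap A F a)).choose_spec.choose_spec.1) (one_ne_zero (α := A))
    (a' := a) ((IsFractionRing.div_surjective A
      (algebraMap A F a)).choose_spec.choose_spec.2.trans (by simp))
  refine Eq.trans h ?_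
  simp

/-- The derivation `x ∂` on `F((x))`, where `d = x ∂` on the coefficients:
`∑ f_m x^m ↦ ∑ (d f_m + m f_m) x^m`. -/
def laurentEuler {k F : Type*} [Field k] [Field F] [Algebra k F] (d : Derivation k F F) :
    LaurentSeries F →+ LaurentSeries F where
  toFun f :=
    { coeff := fun m => d (f.coeff m) + (m : F) * f.coeff m
      isPWO_support' := f.isPWO_support.mono fun m hm => by
        contrapose! hm
        simp only [HahnSeries.mem_support, not_not] at hm
        simp [hm] }
  map_zero' := by ext m; simp
  map_add' f g := by ext m; simp; ring

theorem laurentEuler_mul {k F : Type*} [Field k] [Field F] [Algebra k F] (d : Derivation k F F)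
    (f g : LaurentSeries F) :
    laurentEuler d (f * g) = f * laurentEuler d g + laurentEuler d f * g := by
  have hc : ∀ f m, (laurentEuler d f).coeff m = d (f.coeff m) + (m : F) * f.coeff m :=
    fun _ _ => rfl
  have hsupp : ∀ f, (laurentEuler d f).support ⊆ f.support := fun f m hm => by
    contrapose! hm
    simp only [HahnSeries.mem_support, not_not] at hm
    simp [hc, hm]
  ext m
  rw [HahnSeries.coeff_add, HahnSeries.coeff_mul_right' g.isPWO_support (hsupp g),
    HahnSeries.coeff_mul_left' f.isPWO_support (hsupp f), hc]
  simp only [hc, HahnSeries.coeff_mul, map_sum, Finset.mul_sum, ← Finset.sum_add_distrib]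
  refine Finset.sum_congr rfl fun ij h => ?_
  have h3 : ij.1 + ij.2 = m := by
    simpa using (Finset.mem_antidiagonal.1 h).2.2
  rw [Derivation.leibniz, ← h3]
  push_cast
  simp only [smul_eq_mul]
  ring

/-- The field `k(z) = k(z₁, z₂, …)`; the variable `z_{i+1}` has index `i`. -/
abbrev RatZ (k : Type*) [Field k] : Type _ := FractionRing (MvPolynomial ℕ k)
/-- The group algebra of the additive group of `k` over `k(z)((x))`. -/
abbrev EPCAlg (k : Type*) [Field k] : Type _ := AddMonoidAlgebra (LaurentSeries (RatZ k)) k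

/-- The Euler-primitive closure `R = ⨁_{ρ ∈ k} t^ρ k(z)((x))`, the group algebra of the additive
group of `k` over `k(z)((x))`. -/
def EPC (k : Type*) [Field k] : Type _ := EPCAlg k

instance (k : Type*) [Field k] : CommRing (EPC k) := inferInstanceAs (CommRing (EPCAlg k))

/-- The element `t^ρ f` of `R`. -/
def tMul {k : Type*} [Field k] (ρ : k) (f : LaurentSeries (RatZ k)) : EPC k :=
  (AddMonoidAlgebra.single ρ f : EPCAlg k)

/-- The variable `z_{i+1}`. -/
def zVar (k : Type*) [Field k] (i : ℕ) : RatZ k :=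
  algebraMap (MvPolynomial ℕ k) (RatZ k) (MvPolynomial.X i)

/-- The derivation `x ∂` on `k(z)`: it is zero on `k`, and `x ∂ z_{i+1} = 1 / (z₁ ⋯ z_i)`. -/
def zEuler (k : Type*) [Field k] : Derivation k (RatZ k) (RatZ k) :=
  fracDeriv (MvPolynomial.mkDerivation k fun i => (∏ j ∈ Finset.range i, zVar k j)⁻¹)

/-- The map `x ∂` on `R`: `t^ρ f ↦ t^ρ (x ∂ f + ρ f)`. -/
def eulerAlg (k : Type*) [Field k] : EPCAlg k →+ EPCAlg k :=
  (Finsupp.liftAddHom fun ρ : k =>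
      (AddMonoidAlgebra.singleAddHom ρ).comp
        (laurentEuler (zEuler k) +
          AddMonoidHom.mulLeft (HahnSeries.C (algebraMap k (RatZ k) ρ)))).comp
    AddMonoidAlgebra.coeffAddEquiv.toAddMonoidHom

theorem eulerAlg_single {k : Type*} [Field k] (ρ : k) (f : LaurentSeries (RatZ k)) :
    eulerAlg k (AddMonoidAlgebra.single ρ f) = AddMonoidAlgebra.single ρ
      (laurentEuler (zEuler k) f + HahnSeries.C (algebraMap k (RatZ k) ρ) * f) := by
  simp [eulerAlg]

theorem eulerAlg_mul {k : Type*} [Field k] (y w : EPCAlg k) :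
    eulerAlg k (y * w) = y * eulerAlg k w + eulerAlg k y * w := by
  induction y using AddMonoidAlgebra.induction_linear with
  | zero => simp
  | add u v h h' => rw [add_mul, map_add, map_add, h, h']; ring
  | single ρ f =>
    induction w using AddMonoidAlgebra.induction_linear with
    | zero => simp
    | add u v h h' => rw [mul_add, map_add, map_add, h, h']; ring
    | single σ g =>
      rw [AddMonoidAlgebra.single_mul_single, eulerAlg_single, eulerAlg_single, eulerAlg_single,
        AddMonoidAlgebra.single_mul_single,
        AddMonoidAlgebra.single_mul_single, ← AddMonoidAlgebra.single_add, laurentEuler_mul,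
        map_add, map_add]
      congr 1
      ring

/-- The map `x ∂` on `R`. -/
def euler (k : Type*) [Field k] : EPC k →+ EPC k where
  toFun := eulerAlg k
  map_zero' := (eulerAlg k).map_zero
  map_add' := (eulerAlg k).map_add

theorem euler_tMul {k : Type*} [Field k] (ρ : k) (f : LaurentSeries (RatZ k)) :
    euler k (tMul ρ f) =
      tMul ρ (laurentEuler (zEuler k) f + HahnSeries.C (algebraMap k (RatZ k) ρ) * f) :=
  eulerAlg_single ρ f

theorem euler_mul {k : Type*} [Field k] (y w : EPC k) :
    euler k (y * w) = y * euler k w + euler k y * w :=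
  eulerAlg_mul (k := k) y w

/-- The element `x ^ m` of `R`. -/
def xPow (k : Type*) [Field k] (m : ℤ) : EPC k :=
  tMul 0 (HahnSeries.single m 1)

/-- The derivation `∂` of `R`. -/
def der (k : Type*) [Field k] : EPC k →+ EPC k :=
  (AddMonoidHom.mulLeft (xPow k (-1))).comp (euler k)

theorem der_mul {k : Type*} [Field k] (y w : EPC k) :
    der k (y * w) = y * der k w + der k y * w := by
  simp only [der, AddMonoidHom.comp_apply, AddMonoidHom.coe_mulLeft, euler_mul]
  ring

/-- The ring of constants of `R`. -/
def constants (k : Type*) [Field k] : Subring (EPC k) where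
  carrier := {c | der k c = 0}
  zero_mem' := map_zero _
  one_mem' := by
    change der k 1 = 0
    have h := der_mul (1 : EPC k) 1
    simpa using h
  add_mem' {a b} ha hb := by
    change der k (a + b) = 0
    rw [map_add, show der k a = 0 from ha, show der k b = 0 from hb, add_zero]
  neg_mem' {a} ha := by
    change der k (-a) = 0
    rw [map_neg, show der k a = 0 from ha, neg_zero]
  mul_mem' {a b} ha hb := by
    change der k (a * b) = 0
    rw [der_mul, show der k a = 0 from ha, show der k b = 0 from hb, mul_zero, zero_mul, add_zero]

/-! ### Differential operators -/

/-- A differential operator `L = ∑_j p_j ∂^j` with `p_j ∈ k[[x]]`, given by its coefficients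
`j ↦ p_j`. -/
abbrev DiffOp (k : Type*) [Field k] : Type _ := ℕ →₀ PowerSeries k

/-- The inclusion of `k[[x]]` in `R`. -/
def ofSeries (k : Type*) [Field k] : PowerSeries k →+* EPC k :=
  (AddMonoidAlgebra.singleZeroRingHom : LaurentSeries (RatZ k) →+* EPCAlg k).comp
    ((HahnSeries.ofPowerSeries ℤ (RatZ k)).comp (PowerSeries.map (algebraMap k (RatZ k))))

namespace DiffOp

variable {k : Type*} [Field k]

/-- The action of `L` on `R`. -/
def act (L : DiffOp k) (y : EPC k) : EPC k :=
  L.sum fun j a => ofSeries k a * (der k)^[j] y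

/-- The order `n` of `L`. -/
def order (L : DiffOp k) : ℕ := L.support.sup id

/-- The shift `τ` of `L = ∑ c_{ij} x^i ∂^j`, the least `i - j` with `c_{ij} ≠ 0`. -/
def shift (L : DiffOp k) : ℤ :=
  sInf {m : ℤ | ∃ i j : ℕ, PowerSeries.coeff i (L j) ≠ 0 ∧ m = (i : ℤ) - j}

/-- The initial form `L₀ = ∑_{i - j = τ} c_{ij} x^i ∂^j`. -/
def initialForm (L : DiffOp k) : DiffOp k :=
  Finsupp.onFinset L.support
    (fun j => PowerSeries.mk fun i =>
      if (i : ℤ) - j = L.shift then PowerSeries.coeff i (L j) else 0)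
    (fun j hj => by
      contrapose! hj
      ext i
      simp [Finsupp.notMem_support_iff.1 hj])

/-- `L` has a regular singularity at `0`: the initial form has the same order as `L`. -/
def IsRegularSingular (L : DiffOp k) : Prop :=
  L ≠ 0 ∧ L.initialForm.order = L.order

/-- The operator `x^{-τ} L`, of shift zero. -/
def normalize (L : DiffOp k) : DiffOp k :=
  L.mapRange
    (fun a => PowerSeries.mk fun i =>
      if 0 ≤ (i : ℤ) + L.shift then PowerSeries.coeff ((i : ℤ) + L.shift).toNat a else 0)
    (by ext i; simp)

/-- The indicial polynomial `χ_L(s) = ∑_j c_{jj} s (s - 1) ⋯ (s - j + 1)`, where the `c_{ij}` are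
the coefficients of `x^{-τ} L`. -/
def indicial (L : DiffOp k) : Polynomial k :=
  L.normalize.sum fun j a => Polynomial.C (PowerSeries.coeff j a) * descPochhammer k j

/-- The local exponents of `L` (here in `k`, which will be algebraically closed). -/
def IsLocalExponent (L : DiffOp k) (ρ : k) : Prop := L.indicial.IsRoot ρ

/-- The multiplicity `m_ρ`; it is zero if `ρ` is not a local exponent. -/
def mult (L : DiffOp k) (ρ : k) : ℕ := L.indicial.rootMultiplicity ρ

theorem der_iterate_mul {c : EPC k} (hc : der k c = 0) (j : ℕ) (y : EPC k) :
    (der k)^[j] (c * y) = c * (der k)^[j] y := by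
  induction j with
  | zero => rfl
  | succ j ih =>
    rw [Function.iterate_succ_apply', Function.iterate_succ_apply', ih, der_mul, hc, zero_mul,
      add_zero]

/-- The solutions of `L y = 0` in `R`, as a module over the constants. -/
def solutions (L : DiffOp k) : Submodule (constants k) (EPC k) where
  carrier := {y | L.act y = 0}
  zero_mem' := by simp [act, Finsupp.sum]
  add_mem' {y w} hy hw := by
    change L.act (y + w) = 0
    have h : L.act (y + w) = L.act y + L.act w := by
      simp [act, Finsupp.sum, mul_add, Finset.sum_add_distrib]
    rw [h, show L.act y = 0 from hy, show L.act w = 0 from hw, add_zero]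
  smul_mem' c y hy := by
    change L.act ((c : EPC k) * y) = 0
    have h : L.act ((c : EPC k) * y) = (c : EPC k) * L.act y := by
      simp only [act, Finsupp.sum, der_iterate_mul (c.2 : der k (c : EPC k) = 0),
        mul_left_comm _ (c : EPC k), Finset.mul_sum]
    rw [h, show L.act y = 0 from hy, mul_zero]

end DiffOp

/-! ### Function spaces -/

section Spaces

variable {k : Type*} [Field k]

/-- The monomial `z^α`. -/
def zMon (k : Type*) [Field k] (α : ℕ →₀ ℕ) : RatZ k := α.prod fun i a => zVar k i ^ a

/-- The set `t^ρ ∑_{m ≥ 0} (⨁_{α ∈ A_m} k z^α) x^m`. -/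
def seriesSpace (ρ : k) (A : ℕ → Set (ℕ →₀ ℕ)) : Set (EPC k) :=
  {y | ∃ f : LaurentSeries (RatZ k), y = tMul ρ f ∧
    (∀ m : ℤ, m < 0 → f.coeff m = 0) ∧
    ∀ m : ℕ, f.coeff (m : ℤ) ∈ Submodule.span k (zMon k '' A m)}

/-- `e(α) = ∑_j p^j \bar α_{j+1}`, where `\bar a` is the remainder of `a` modulo `p`. -/
def eWeight (p : ℕ) (α : ℕ →₀ ℕ) : ℕ := α.sum fun j a => (a % p) * p ^ j

/-- `i^* = (i, ⌊i/p⌋, ⌊i/p²⌋, …)`. -/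
def floorSeq (p : ℕ) [Fact p.Prime] (i : ℕ) : ℕ →₀ ℕ :=
  Finsupp.onFinset (Finset.range (i + 1)) (fun j => i / p ^ j) (fun j hj => by
    have hp : 1 < p := (Fact.out : p.Prime).one_lt
    have h1 : p ^ j ≤ i := by
      by_contra h
      exact hj (Nat.div_eq_of_lt (not_le.1 h))
    have h2 : j < p ^ j := Nat.lt_pow_self hp
    exact Finset.mem_range.2 (by omega))

/-- The element `t^ρ z^α` of `R`. -/
def tzMon (ρ : k) (α : ℕ →₀ ℕ) : EPC k :=
  tMul ρ (HahnSeries.C (zMon k α))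

namespace DiffOp

/-- `ξ(m) = m_ρ + m_{ρ+1} + ⋯ + m_{ρ+m}`. -/
def xi (L : DiffOp k) (ρ : k) (m : ℕ) : ℕ := ∑ i ∈ Finset.range (m + 1), L.mult (ρ + i)

/-- `A_m = {α | α₁ < ξ(m), α_{j+1} ≤ α_j / p for all j}`. -/
def exponentSet (p : ℕ) (L : DiffOp k) (ρ : k) (m : ℕ) : Set (ℕ →₀ ℕ) :=
  {α | α 0 < L.xi ρ m ∧ ∀ j, p * α (j + 1) ≤ α j}

/-- The `ρ`-function space `F = t^ρ ∑_{m ≥ 0} (⨁_{α ∈ A_m} k z^α) x^m`. -/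
def functionSpace (p : ℕ) (L : DiffOp k) (ρ : k) : Set (EPC k) :=
  seriesSpace ρ (L.exponentSet p ρ)

/-- The space `F x`. -/
def functionSpaceX (p : ℕ) (L : DiffOp k) (ρ : k) : Set (EPC k) :=
  (fun y => y * xPow k 1) '' L.functionSpace p ρ

/-- The complement `H` of the kernel of `L₀` in `F`, topologically spanned by the monomials
`t^ρ x^m z^α` with `α ∈ A_m` and `e(α) ≥ m_{ρ+m}`. -/
def complementSpace (p : ℕ) (L : DiffOp k) (ρ : k) : Set (EPC k) :=
  seriesSpace ρ fun m => {α | α ∈ L.exponentSet p ρ m ∧ L.mult (ρ + m) ≤ eWeight p α}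

/-- The action of the initial form `L₀` of `x^{-τ} L`. -/
def actInitial (L : DiffOp k) (y : EPC k) : EPC k := L.normalize.initialForm.act y

/-- The action of `T = L₀ - x^{-τ} L`. -/
def actT (L : DiffOp k) (y : EPC k) : EPC k := L.actInitial y - L.normalize.act y

/-- The right inverse `S = (L₀|_H)⁻¹ : F x → H` of `L₀`. -/
def rightInv (p : ℕ) (L : DiffOp k) (ρ : k) : EPC k → EPC k :=
  Function.invFunOn L.actInitial (L.complementSpace p ρ)

/-- The automorphism `u_ρ = Id - S ∘ T` of `F`. -/
def autU (p : ℕ) (L : DiffOp k) (ρ : k) (y : EPC k) : EPC k :=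
  y - L.rightInv p ρ (L.actT y)

/-- The inverse `u_ρ⁻¹ : F → F`. -/
def autUInv (p : ℕ) (L : DiffOp k) (ρ : k) : EPC k → EPC k :=
  Function.invFunOn (L.autU p ρ) (L.functionSpace p ρ)

end DiffOp

end Spaces

end EulerPrimitive

end

/-!
Write `δ = x ∂`. On the part `t^ρ x^m k(z)` of `R` the operator `δ` acts as `d + ρ + m`, where `d`
is the derivation `zEuler` of `k(z)`. Hence `L₀ = χ(δ)` acts coefficientwise, as `χ(d + ρ + m)` on
the coefficient of `t^ρ x^m` (`DiffOp.cf_actInitial`), while `T = L₀ - M` strictly raises the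
order in `x` (`DiffOp.cf_actT_mem`). All questions about `L₀` are thus questions about `d` on
`k(z)`.

The monomials `w_e = z^{e^*}`, `e = 0, 1, 2, …`, behave like divided powers for `d`: one has
`d w_e = c w_{e-1} + …` with `c ∈ k` nonzero, where the further terms are combinations of the `w_i`,
`i < e - 1`, with constant coefficients (`zEuler_wMon_succ`). Moreover each monomial `z^α` is a
constant multiple of `w_{e(α)}`, and every fraction is a polynomial up to the constant factor
given by the `p`-th power of its denominator, so the `w_e` form a basis of `k(z)` over its
constants (`wBasis`). It follows that `d` is surjective and locally nilpotent, that `d^μ` has the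
kernel spanned by the `w_e` with `e < μ`, and that it maps the span of the `w_e` with `e ≥ μ`
bijectively to `k(z)`. If `μ` is the multiplicity of `s` as a root of `χ`, then `χ(d + s)` is the
product of `d^μ` and of a locally invertible operator, so that it has the same properties. The
spans of floor chains (`chainSpan`), from which the function spaces are built, are compatible with
this: `z^α = z^σ w_{e(α)}` with `z^σ` constant and `σ₁ + e(α) = α₁`, and `d` lowers `α₁` by one
(`exists_mem_chainUpper_aeval_zD_eq`).

So `L₀` is surjective on `R`, and it has a right inverse `S` that is linear over the constants of
`R` and restricts to the inverse of `L₀ : H → F x` for each local exponent (`DiffOp.sectionLin`).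
As `S ∘ T` raises the order in `x`, the map `u = Id - S ∘ T` is bijective on `R` and on every
function space, by a geometric series (`exists_sub_apply_eq`). Since `L₀ ∘ u = L₀ - T = M` is `L`
up to a power of `x`, the solutions are the image under `u⁻¹` of the kernel of `L₀`. That kernel
consists of the sums with coefficients in `ker d^{m_{ρ+m}}` at `t^ρ x^m`. The constants of `R` are
supported in the terms `t^τ x^m` with `τ + m = 0` in `k` and have constant coefficients, so the
`t^ρ w_i` with `i < m_ρ` form a basis of the kernel over the constants
(`DiffOp.mem_span_tzMon_iff`). There are `deg χ = n` of them.

The constants form a field because `t^ρ ↦ 1` is injective on them and the `p`-th power map of `R`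
factors through it, which makes the `p`-th power of a nonzero constant a unit
(`isField_constants`).
-/

noncomputable section
namespace EulerPrimitive

/-! ### Base-`p` digits of exponents -/

section Combinatorics

/-- The sequences `α` with `α_{j+1} ≤ α_j / p` for all `j`. -/
def IsFloorChain (p : ℕ) (α : ℕ →₀ ℕ) : Prop := ∀ j, p * α (j + 1) ≤ α j

theorem IsFloorChain.add {p : ℕ} {α β : ℕ →₀ ℕ} (hα : IsFloorChain p α) (hβ : IsFloorChain p β) :
    IsFloorChain p (α + β) := fun j => by
  simpa [mul_add] using add_le_add (hα j) (hβ j)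

variable {p : ℕ} [Fact p.Prime]

theorem floorSeq_apply (e j : ℕ) : floorSeq p e j = e / p ^ j := rfl

theorem floorSeq_zero : floorSeq p 0 = 0 := by
  ext j; simp [floorSeq_apply]

theorem isFloorChain_floorSeq (e : ℕ) : IsFloorChain p (floorSeq p e) := fun j => by
  rw [floorSeq_apply, floorSeq_apply, pow_succ, ← Nat.div_div_eq_div_mul]
  exact Nat.mul_div_le _ _

theorem IsFloorChain.eq_zero {α : ℕ →₀ ℕ} (hα : IsFloorChain p α) (h0 : α 0 = 0) : α = 0 := by
  have hp : 0 < p := (Fact.out : p.Prime).pos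
  ext j
  induction j with
  | zero => simpa using h0
  | succ j ih =>
    have h := hα j
    rw [ih] at h
    simpa [hp.ne'] using h

theorem digitSum_div_mod (n : ℕ) : ∀ a : ℕ → ℕ, (∀ j, n ≤ j → a j = 0) → ∀ j,
    (∑ i ∈ Finset.range n, a i % p * p ^ i) / p ^ j % p = a j % p := by
  have hp : 0 < p := (Fact.out : p.Prime).pos
  induction n with
  | zero => intro a ha j; simp [ha j]
  | succ n ih =>
    intro a ha j
    have e : ∑ i ∈ Finset.range (n + 1), a i % p * p ^ i =
        a 0 % p + p * ∑ i ∈ Finset.range n, a (i + 1) % p * p ^ i := by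
      rw [Finset.sum_range_succ', Finset.mul_sum, add_comm]
      congr 1
      · simp
      · exact Finset.sum_congr rfl fun i _ => by ring
    rw [e]
    cases j with
    | zero => simp
    | succ j =>
      rw [pow_succ', ← Nat.div_div_eq_div_mul, Nat.add_mul_div_left _ _ hp,
        Nat.div_eq_of_lt (Nat.mod_lt _ hp), zero_add]
      exact ih (fun i => a (i + 1)) (fun j hj => ha _ (by omega)) j

/-- The base-`p` digits of `e(α)` are the remainders of the `α_j`. -/
theorem eWeight_div_mod (α : ℕ →₀ ℕ) (j : ℕ) : eWeight p α / p ^ j % p = α j % p := by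
  obtain ⟨n, hn⟩ := α.support.exists_nat_subset_range
  have h : eWeight p α = ∑ i ∈ Finset.range n, α i % p * p ^ i :=
    Finsupp.sum_of_support_subset _ hn _ (by simp)
  rw [h]
  refine digitSum_div_mod n α (fun j hj => ?_) j
  by_contra h0
  have := Finset.mem_range.1 (hn (Finsupp.mem_support_iff.2 h0))
  omega

theorem dvd_add_floorSeq_eWeight (α : ℕ →₀ ℕ) (j : ℕ) :
    p ∣ (α + (p - 1) • floorSeq p (eWeight p α)) j := by
  have hp : 0 < p := (Fact.out : p.Prime).pos
  have h : floorSeq p (eWeight p α) j ≡ α j [MOD p] := eWeight_div_mod α j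
  have h2 : (α + (p - 1) • floorSeq p (eWeight p α)) j ≡ α j + (p - 1) * α j [MOD p] := by
    simpa using (Nat.ModEq.refl (α j)).add (h.mul_left (p - 1))
  have h3 : α j + (p - 1) * α j = p * α j := by
    obtain ⟨q, rfl⟩ : ∃ q, p = q + 1 := ⟨p - 1, by omega⟩
    simp; ring
  rw [h3] at h2
  exact (h2.dvd_iff dvd_rfl).2 (dvd_mul_right _ _)

/-- A floor chain `α` is the sum of the sequence `i^*`, `i = e(α)`, and of a floor chain
divisible by `p`. -/
theorem IsFloorChain.exists_add {α : ℕ →₀ ℕ} (hα : IsFloorChain p α) :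
    ∃ σ : ℕ →₀ ℕ, α = σ + floorSeq p (eWeight p α) ∧ IsFloorChain p σ ∧ ∀ j, p ∣ σ j := by
  have hp : 0 < p := (Fact.out : p.Prime).pos
  have hp1 : 1 < p := (Fact.out : p.Prime).one_lt
  set f := floorSeq p (eWeight p α) with hf
  have hmod : ∀ j, f j % p = α j % p := eWeight_div_mod α
  have hdiv : ∀ j, f j = α j % p + p * f (j + 1) := fun j => by
    have h1 : f (j + 1) = f j / p := by
      rw [hf, floorSeq_apply, floorSeq_apply, pow_succ, Nat.div_div_eq_div_mul]
    rw [h1, ← hmod, Nat.mod_add_div]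
  have hle : ∀ j, f j ≤ α j := by
    intro j
    -- descending induction from an index beyond the support of `f`
    obtain ⟨n, hn⟩ : ∃ n, ∀ i, n ≤ i → f i = 0 := by
      obtain ⟨n, hn⟩ := f.support.exists_nat_subset_range
      refine ⟨n, fun i hi => ?_⟩
      by_contra h0
      have := Finset.mem_range.1 (hn (Finsupp.mem_support_iff.2 h0))
      omega
    have key : ∀ m i, n ≤ i + m → f i ≤ α i := by
      intro m
      induction m with
      | zero => intro i hi; rw [hn i hi]; exact Nat.zero_le _
      | succ m ih =>
        intro i hi
        have h1 := ih (i + 1) (by omega)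
        have h2 : α (i + 1) ≤ α i / p := (Nat.le_div_iff_mul_le hp).2 (by linarith [hα i])
        have h3 := Nat.mod_add_div (α i) p
        have h4 := Nat.mul_le_mul_left p (h1.trans h2)
        have := hdiv i
        omega
    exact key n j (by omega)
  refine ⟨α - f, (tsub_add_cancel_of_le hle).symm, fun j => ?_, fun j => ?_⟩
  · have h1 := hdiv j
    have h2 : α (j + 1) ≤ α j / p := (Nat.le_div_iff_mul_le hp).2 (by linarith [hα j])
    have h3 := Nat.mod_add_div (α j) p
    have h4 := Nat.mul_le_mul_left p h2
    simp only [Finsupp.coe_tsub, Pi.sub_apply, Nat.mul_sub]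
    omega
  · exact (Nat.modEq_iff_dvd' (hle j)).1 (hmod j)

/-- The sequence `(1, …, 1, 0, …)` with ones at the indices `0, …, j`. -/
def onesUpTo (j : ℕ) : ℕ →₀ ℕ :=
  Finsupp.onFinset (Finset.range (j + 1)) (fun i => if i ≤ j then 1 else 0) (by
    intro i hi
    simp only [ne_eq, ite_eq_right_iff, one_ne_zero, imp_false, not_not] at hi
    simpa [Nat.lt_succ_iff] using hi)

theorem onesUpTo_apply (j i : ℕ) : onesUpTo j i = if i ≤ j then 1 else 0 := rfl

theorem IsFloorChain.onesUpTo_le {α : ℕ →₀ ℕ} (hα : IsFloorChain p α) {j : ℕ} (hj : α j ≠ 0) :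
    onesUpTo j ≤ α := by
  have hp : 0 < p := (Fact.out : p.Prime).pos
  have key : ∀ m i, i + m = j → α i ≠ 0 := by
    intro m
    induction m with
    | zero => rintro i rfl; exact hj
    | succ m ih =>
      intro i hi
      have h1 := ih (i + 1) (by omega)
      have h2 := hα i
      have h3 : 0 < p * α (i + 1) := Nat.mul_pos hp (Nat.pos_of_ne_zero h1)
      omega
  intro i
  rw [onesUpTo_apply]
  split_ifs with h
  · exact Nat.one_le_iff_ne_zero.2 (key (j - i) i (by omega))
  · exact Nat.zero_le _

theorem IsFloorChain.sub_onesUpTo {α : ℕ →₀ ℕ} (hα : IsFloorChain p α) {j : ℕ}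
    (hj : ¬ p ∣ α j) : IsFloorChain p (α - onesUpTo j) := fun i => by
  have hp1 : 1 < p := (Fact.out : p.Prime).one_lt
  have h := hα i
  have hne : i = j → p * α (i + 1) ≠ α i := by
    rintro rfl h1
    exact hj ⟨_, h1.symm⟩
  simp only [Finsupp.coe_tsub, Pi.sub_apply, onesUpTo_apply, Nat.mul_sub]
  split_ifs <;> simp <;> omega

/-- Exactly one of the sequences `e^* - (1, …, 1, 0, …)` is `(e - 1)^*`. -/
theorem floorSeq_sub_onesUpTo_padicValNat {e : ℕ} (he : e ≠ 0) :
    floorSeq p e - onesUpTo (padicValNat p e) = floorSeq p (e - 1) := by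
  have hp : p.Prime := Fact.out
  ext i
  simp only [Finsupp.coe_tsub, Pi.sub_apply, onesUpTo_apply, floorSeq_apply]
  have h1 : i ≤ padicValNat p e ↔ p ^ i ∣ e := (padicValNat_dvd_iff_le he).symm
  obtain ⟨e, rfl⟩ : ∃ e', e = e' + 1 := ⟨e - 1, by omega⟩
  simp only [h1, Nat.add_sub_cancel, Nat.succ_div]

theorem not_dvd_floorSeq_padicValNat {e : ℕ} (he : e ≠ 0) :
    ¬ p ∣ floorSeq p e (padicValNat p e) := by
  rw [floorSeq_apply]
  intro h
  have h2 : p ^ (padicValNat p e + 1) ∣ e := by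
    rw [pow_succ]
    exact (Nat.dvd_div_iff_mul_dvd pow_padicValNat_dvd).1 h
  exact pow_succ_padicValNat_not_dvd he h2

theorem eq_padicValNat_of_floorSeq_sub {e j : ℕ} (he : e ≠ 0)
    (h : floorSeq p e - onesUpTo j = floorSeq p (e - 1)) (hj : floorSeq p e j ≠ 0) :
    j = padicValNat p e := by
  rw [← floorSeq_sub_onesUpTo_padicValNat he] at h
  have h1 := (isFloorChain_floorSeq (p := p) e).onesUpTo_le hj
  have h2 := (isFloorChain_floorSeq (p := p) e).onesUpTo_le (j := padicValNat p e)
    (fun h0 => not_dvd_floorSeq_padicValNat (p := p) he (by rw [h0]; exact dvd_zero _))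
  have h3 : onesUpTo j = onesUpTo (padicValNat p e) := by
    ext i
    have := h1 i
    have := h2 i
    have := DFunLike.congr_fun h i
    simp only [Finsupp.coe_tsub, Pi.sub_apply] at this
    omega
  have h4 := DFunLike.congr_fun h3 j
  have h5 := DFunLike.congr_fun h3 (padicValNat p e)
  simp only [onesUpTo_apply, le_refl, if_true] at h4 h5
  split_ifs at h4 h5
  omega

end Combinatorics

/-! ### Monomials and their derivatives -/

section Monomials

variable {k : Type*} [Field k]

theorem zVar_ne_zero (i : ℕ) : zVar k i ≠ 0 := by
  simp [zVar, MvPolynomial.X_ne_zero]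

theorem zMon_eq_algebraMap (α : ℕ →₀ ℕ) :
    zMon k α = algebraMap (MvPolynomial ℕ k) (RatZ k) (MvPolynomial.monomial α 1) := by
  rw [MvPolynomial.monomial_eq, map_one, one_mul, Finsupp.prod, map_prod]
  simp [zMon, zVar, Finsupp.prod]

theorem zMon_ne_zero (α : ℕ →₀ ℕ) : zMon k α ≠ 0 := by
  rw [zMon, Finsupp.prod]
  exact Finset.prod_ne_zero_iff.2 fun i _ => pow_ne_zero _ (zVar_ne_zero i)

theorem zMon_zero : zMon k 0 = 1 := by simp [zMon]

theorem zMon_add (α β : ℕ →₀ ℕ) : zMon k (α + β) = zMon k α * zMon k β := by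
  simp [zMon_eq_algebraMap, ← map_mul, MvPolynomial.monomial_mul]

theorem zMon_onesUpTo (j : ℕ) :
    zMon k (onesUpTo j) = (∏ i ∈ Finset.range j, zVar k i) * zVar k j := by
  rw [← Finset.prod_range_succ, zMon, Finsupp.prod_of_support_subset (s := Finset.range (j + 1))]
  · refine Finset.prod_congr rfl fun i hi => ?_
    rw [onesUpTo_apply, if_pos (by simpa [Nat.lt_succ_iff] using hi), pow_one]
  · exact Finsupp.support_onFinset_subset
  · simp

/-- `x ∂ z^α = ∑_j α_j z^α / (z₁ ⋯ z_j)`. -/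
theorem zEuler_zMon (α : ℕ →₀ ℕ) : zEuler k (zMon k α) =
    ∑ j ∈ α.support, (α j : k) • (zMon k α / zMon k (onesUpTo j)) := by
  rw [zEuler, zMon_eq_algebraMap, fracDeriv_algebraMap, MvPolynomial.mkDerivation_monomial,
    one_smul, Finsupp.sum]
  refine Finset.sum_congr rfl fun j hj => ?_
  have h1 : α = (α - Finsupp.single j 1) + Finsupp.single j 1 :=
    (tsub_add_cancel_of_le (Finsupp.single_le_iff.2
      (Nat.one_le_iff_ne_zero.2 (Finsupp.mem_support_iff.1 hj)))).symm
  have h2 : (MvPolynomial.monomial α (1 : k)) =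
      MvPolynomial.monomial (α - Finsupp.single j 1) 1 * MvPolynomial.X j := by
    conv_lhs => rw [h1]
    simp [MvPolynomial.X, MvPolynomial.monomial_mul]
  have h3 : MvPolynomial.monomial (α - Finsupp.single j 1) (α j : k) =
      (α j : k) • MvPolynomial.monomial (α - Finsupp.single j 1) (1 : k) := by
    simp [MvPolynomial.smul_monomial]
  rw [h3, h2, zMon_onesUpTo, smul_assoc, map_mul]
  congr 1
  rw [Algebra.smul_def]
  change _ = _ * zVar k j / _
  have := zVar_ne_zero (k := k) j
  rw [mul_div_mul_right _ _ this, div_eq_mul_inv]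

theorem zMon_div_onesUpTo {α : ℕ →₀ ℕ} {j : ℕ} (h : onesUpTo j ≤ α) :
    zMon k α / zMon k (onesUpTo j) = zMon k (α - onesUpTo j) := by
  rw [div_eq_iff (zMon_ne_zero _), ← zMon_add, tsub_add_cancel_of_le h]

theorem zEuler_zMon_eq_zero {p : ℕ} [CharP k p] {α : ℕ →₀ ℕ} (hα : ∀ j, p ∣ α j) :
    zEuler k (zMon k α) = 0 := by
  rw [zEuler_zMon]
  refine Finset.sum_eq_zero fun j _ => ?_
  rw [(CharP.cast_eq_zero_iff k p _).2 (hα j), zero_smul]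

/-- The monomial `z^{e^*}`, `e^* = (e, ⌊e/p⌋, ⌊e/p²⌋, …)`. -/
def wMon (p : ℕ) [Fact p.Prime] (k : Type*) [Field k] (e : ℕ) : RatZ k := zMon k (floorSeq p e)

variable {p : ℕ} [Fact p.Prime]

theorem wMon_zero : wMon p k 0 = 1 := by rw [wMon, floorSeq_zero, zMon_zero]

variable [CharP k p]

/-- `z^α` is a constant multiple of `z^{e^*}`, `e = e(α)`. -/
theorem exists_zMon_eq_mul_wMon (α : ℕ →₀ ℕ) :
    ∃ a : RatZ k, zEuler k a = 0 ∧ zMon k α = a * wMon p k (eWeight p α) := by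
  have hp : 0 < p := (Fact.out : p.Prime).pos
  set f := floorSeq p (eWeight p α) with hf
  have h1 : zEuler k (zMon k (α + (p - 1) • f)) = 0 :=
    zEuler_zMon_eq_zero (dvd_add_floorSeq_eWeight α)
  have h2 : zEuler k (zMon k (p • f)) = 0 :=
    zEuler_zMon_eq_zero fun j => ⟨f j, by simp⟩
  refine ⟨zMon k (α + (p - 1) • f) / zMon k (p • f), ?_, ?_⟩
  · rw [Derivation.leibniz_div, h1, h2]; simp
  · rw [wMon, ← hf, div_mul_eq_mul_div, eq_div_iff (zMon_ne_zero _), ← zMon_add, ← zMon_add,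
      add_assoc]
    congr 2
    obtain ⟨q, hq⟩ : ∃ q, p = q + 1 := ⟨p - 1, by omega⟩
    rw [hq, Nat.add_sub_cancel, succ_nsmul]

/-- If `α` is a floor chain then `z^α` is the product of `z^{e^*}`, `e = e(α)`, and of a constant
monomial `z^σ` of a floor chain `σ`. -/
theorem IsFloorChain.exists_zMon_eq {α : ℕ →₀ ℕ} (hα : IsFloorChain p α) :
    ∃ σ : ℕ →₀ ℕ, IsFloorChain p σ ∧ zEuler k (zMon k σ) = 0 ∧ σ 0 + eWeight p α = α 0 ∧
      α = σ + floorSeq p (eWeight p α) ∧ zMon k α = zMon k σ * wMon p k (eWeight p α) := by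
  obtain ⟨σ, h1, h2, h3⟩ := hα.exists_add
  refine ⟨σ, h2, zEuler_zMon_eq_zero h3, ?_, h1, ?_⟩
  · have := DFunLike.congr_fun h1 0
    simpa [floorSeq_apply] using this.symm
  · conv_lhs => rw [h1]
    exact zMon_add _ _

/-- The derivative of `z^{e^*}` is a nonzero multiple of `z^{(e-1)^*}`, up to terms
`z^σ z^{i^*}` with `x ∂ z^σ = 0` and `i < e - 1`. -/
theorem zEuler_wMon_succ (e : ℕ) : ∃ c : k, c ≠ 0 ∧
    zEuler k (wMon p k (e + 1)) - c • wMon p k e ∈ Submodule.span k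
      {f | ∃ (σ : ℕ →₀ ℕ) (i : ℕ), IsFloorChain p σ ∧ zEuler k (zMon k σ) = 0 ∧ σ 0 + i = e ∧
        i < e ∧ f = zMon k σ * wMon p k i} := by
  set α := floorSeq p (e + 1) with hα
  set v := padicValNat p (e + 1) with hv
  have hchain : IsFloorChain p α := isFloorChain_floorSeq _
  have hnd : ¬ p ∣ α v := not_dvd_floorSeq_padicValNat (Nat.succ_ne_zero e)
  have hvs : v ∈ α.support := Finsupp.mem_support_iff.2 fun h => hnd (by rw [h]; exact dvd_zero _)
  refine ⟨(α v : k), fun h => hnd ((CharP.cast_eq_zero_iff k p _).1 h), ?_⟩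
  have hsub : α - onesUpTo v = floorSeq p e :=
    floorSeq_sub_onesUpTo_padicValNat (Nat.succ_ne_zero e)
  have hw : wMon p k e = zMon k α / zMon k (onesUpTo v) := by
    rw [zMon_div_onesUpTo (hchain.onesUpTo_le (Finsupp.mem_support_iff.1 hvs)), hsub, wMon]
  rw [hw, wMon, zEuler_zMon, ← Finset.add_sum_erase _ _ hvs, add_sub_cancel_left]
  refine Submodule.sum_mem _ fun j hj => ?_
  obtain ⟨hjv, hjs⟩ := Finset.mem_erase.1 hj
  by_cases hd : p ∣ α j
  · rw [(CharP.cast_eq_zero_iff k p _).2 hd, zero_smul]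
    exact zero_mem _
  refine Submodule.smul_mem _ _ (Submodule.subset_span ?_)
  rw [zMon_div_onesUpTo (hchain.onesUpTo_le (Finsupp.mem_support_iff.1 hjs))]
  obtain ⟨σ, h1, h2, h3, h4, h5⟩ := (hchain.sub_onesUpTo hd).exists_zMon_eq (k := k)
  have h0 : (α - onesUpTo j) 0 = e := by
    simp [onesUpTo_apply, hα, floorSeq_apply]
  rw [h0] at h3
  refine ⟨σ, _, h1, h2, h3, ?_, h5⟩
  -- if `e(α - 1_{≤ j}) = e` then `σ = 0`, which happens for `j = v` only
  by_contra hlt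
  have hσ : σ = 0 := h1.eq_zero (by omega)
  rw [hσ, zero_add, show eWeight p (α - onesUpTo j) = e by omega] at h4
  exact hjv (eq_padicValNat_of_floorSeq_sub (Nat.succ_ne_zero e) h4
    (Finsupp.mem_support_iff.1 hjs))

end Monomials

/-! ### The derivation `x ∂` on `k(z)` -/

section Coefficients

variable {k : Type*} [Field k]

/-- The operator `x ∂ + s` on `k(z)`, which describes the action of `x ∂` on `t^ρ x^m k(z)` for
`s = ρ + m`. -/
def zD (k : Type*) [Field k] (s : k) : Module.End k (RatZ k) :=
  (zEuler k : RatZ k →ₗ[k] RatZ k) + algebraMap k (Module.End k (RatZ k)) s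

theorem zD_apply (s : k) (f : RatZ k) : zD k s f = zEuler k f + s • f := rfl

theorem zD_zero_apply (f : RatZ k) : zD k 0 f = zEuler k f := by simp [zD_apply]

theorem aeval_zD_X_sub_C (s : k) :
    Polynomial.aeval (zD k s) (Polynomial.X - Polynomial.C s) = zD k 0 := by
  simp [zD]

/-- The constants of `k(z)`. -/
def zConst (k : Type*) [Field k] : Subalgebra k (RatZ k) where
  carrier := {f | zEuler k f = 0}
  mul_mem' {a b} ha hb := by
    change zEuler k (a * b) = 0
    rw [Derivation.leibniz, show zEuler k a = 0 from ha, show zEuler k b = 0 from hb]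
    simp
  add_mem' {a b} ha hb := by
    change zEuler k (a + b) = 0
    rw [map_add, show zEuler k a = 0 from ha, show zEuler k b = 0 from hb, add_zero]
  algebraMap_mem' c := (zEuler k).map_algebraMap c

theorem mem_zConst {f : RatZ k} : f ∈ zConst k ↔ zEuler k f = 0 := Iff.rfl

theorem zConst_smul_def (a : zConst k) (f : RatZ k) : a • f = (a : RatZ k) * f := rfl

theorem inv_mem_zConst {a : RatZ k} (ha : a ∈ zConst k) : a⁻¹ ∈ zConst k := by
  rw [mem_zConst, Derivation.leibniz_inv, mem_zConst.1 ha, smul_zero]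

theorem zD_const_mul (s : k) {a : RatZ k} (ha : a ∈ zConst k) (f : RatZ k) :
    zD k s (a * f) = a * zD k s f := by
  rw [zD_apply, zD_apply, Derivation.leibniz, mem_zConst.1 ha, mul_add]
  simp

theorem zD_pow_const_mul (s : k) {a : RatZ k} (ha : a ∈ zConst k) (n : ℕ) (f : RatZ k) :
    (zD k s ^ n) (a * f) = a * (zD k s ^ n) f := by
  induction n with
  | zero => rfl
  | succ n ih => rw [pow_succ', Module.End.mul_apply, ih, zD_const_mul s ha, Module.End.mul_apply]

variable {p : ℕ} [Fact p.Prime] [CharP k p]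

theorem zD_pow_succ_wMon (e : ℕ) : (zD k 0 ^ (e + 1)) (wMon p k e) = 0 := by
  induction e using Nat.strong_induction_on with
  | _ e ih =>
    cases e with
    | zero => simp [wMon_zero, zD_zero_apply]
    | succ e =>
      obtain ⟨c, -, hr⟩ := zEuler_wMon_succ (p := p) (k := k) e
      set r := zEuler k (wMon p k (e + 1)) - c • wMon p k e with hrdef
      have h1 : zD k 0 (wMon p k (e + 1)) = c • wMon p k e + r := by
        rw [zD_zero_apply, hrdef]; abel
      rw [pow_succ, Module.End.mul_apply, h1, map_add, map_smul, ih e (by omega), smul_zero,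
        zero_add]
      refine LinearMap.mem_ker.1 ((Submodule.span_le.2 ?_ :
        _ ≤ LinearMap.ker (zD k 0 ^ (e + 1))) hr)
      rintro _ ⟨σ, i, -, hσ, -, hi, rfl⟩
      rw [SetLike.mem_coe, LinearMap.mem_ker, zD_pow_const_mul 0 hσ,
        show e + 1 = (e - i) + (i + 1) by omega, pow_add, Module.End.mul_apply, ih i (by omega),
        map_zero, mul_zero]

theorem zD_pow_wMon_of_lt {e n : ℕ} (h : e < n) : (zD k 0 ^ n) (wMon p k e) = 0 := by
  rw [show n = (n - (e + 1)) + (e + 1) by omega, pow_add, Module.End.mul_apply, zD_pow_succ_wMon,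
    map_zero]

theorem zD_pow_wMon_ne_zero (e : ℕ) : (zD k 0 ^ e) (wMon p k e) ≠ 0 := by
  induction e with
  | zero => simp [wMon_zero]
  | succ e ih =>
    obtain ⟨c, hc, hr⟩ := zEuler_wMon_succ (p := p) (k := k) e
    set r := zEuler k (wMon p k (e + 1)) - c • wMon p k e with hrdef
    have h1 : zD k 0 (wMon p k (e + 1)) = c • wMon p k e + r := by
      rw [zD_zero_apply, hrdef]; abel
    have h2 : (zD k 0 ^ e) r = 0 := by
      refine LinearMap.mem_ker.1 ((Submodule.span_le.2 ?_ :
        _ ≤ LinearMap.ker (zD k 0 ^ e)) hr)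
      rintro _ ⟨σ, i, -, hσ, -, hi, rfl⟩
      rw [SetLike.mem_coe, LinearMap.mem_ker, zD_pow_const_mul 0 hσ, zD_pow_wMon_of_lt hi,
        mul_zero]
    rw [pow_succ, Module.End.mul_apply, h1, map_add, h2, add_zero, map_smul]
    exact smul_ne_zero hc ih

/-- The top coefficient of a combination of the `z^{e^*}` is detected by a power of `x ∂`. -/
theorem zD_pow_linearCombination (l : ℕ →₀ zConst k) {m : ℕ} (hm : ∀ e, m < e → l e = 0) :
    (zD k 0 ^ m) (Finsupp.linearCombination (zConst k) (wMon p k) l) =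
      l m * (zD k 0 ^ m) (wMon p k m) := by
  rw [Finsupp.linearCombination_apply, Finsupp.sum, map_sum, Finset.sum_eq_single m]
  · rw [zConst_smul_def, zD_pow_const_mul 0 (l m).2]
  · intro e _ hne
    rw [zConst_smul_def, zD_pow_const_mul 0 (l e).2]
    rcases lt_or_gt_of_ne hne with h | h
    · rw [zD_pow_wMon_of_lt h, mul_zero]
    · rw [hm e h]; simp
  · intro h
    rw [Finsupp.notMem_support_iff.1 h, zero_smul, map_zero]

theorem eq_zero_of_zD_pow_linearCombination (l : ℕ →₀ zConst k) {n : ℕ}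
    (h : (zD k 0 ^ n) (Finsupp.linearCombination (zConst k) (wMon p k) l) = 0) {e : ℕ}
    (he : n ≤ e) : l e = 0 := by
  by_contra hne
  have hes : e ∈ l.support := Finsupp.mem_support_iff.2 hne
  set m := l.support.max' ⟨e, hes⟩ with hm
  have hnm : n ≤ m := he.trans (Finset.le_max' _ _ hes)
  have h1 := zD_pow_linearCombination (p := p) l (m := m) fun e' he' => by
    by_contra h0
    exact absurd (Finset.le_max' _ _ (Finsupp.mem_support_iff.2 h0)) (not_le.2 he')
  have h3 : zD k 0 ^ m = zD k 0 ^ (m - n) * zD k 0 ^ n := by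
    rw [← pow_add, Nat.sub_add_cancel hnm]
  rw [show (zD k 0 ^ m) (Finsupp.linearCombination (zConst k) (wMon p k) l) = 0 by
    rw [h3, Module.End.mul_apply, h, map_zero]] at h1
  have h2 : l m ≠ 0 := Finsupp.mem_support_iff.1 (Finset.max'_mem _ _)
  exact mul_ne_zero (fun h0 => h2 (Subtype.ext h0)) (zD_pow_wMon_ne_zero m) h1.symm

theorem span_wMon_eq_top : Submodule.span (zConst k) (Set.range (wMon p k)) = ⊤ := by
  rw [eq_top_iff]
  have hmon : ∀ α, zMon k α ∈ Submodule.span (zConst k) (Set.range (wMon p k)) := fun α => by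
    obtain ⟨a, ha, h⟩ := exists_zMon_eq_mul_wMon (p := p) (k := k) α
    rw [h]
    exact Submodule.smul_mem _ (⟨a, ha⟩ : zConst k) (Submodule.subset_span ⟨_, rfl⟩)
  have hpoly : ∀ q : MvPolynomial ℕ k, algebraMap _ (RatZ k) q ∈
      Submodule.span (zConst k) (Set.range (wMon p k)) := fun q => by
    induction q using MvPolynomial.induction_on' with
    | monomial α c =>
      have h : algebraMap (MvPolynomial ℕ k) (RatZ k) (MvPolynomial.monomial α c) =
          algebraMap k (zConst k) c • zMon k α := by
        rw [zMon_eq_algebraMap, algebraMap_smul, ← algebraMap.coe_smul,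
          MvPolynomial.smul_monomial, smul_eq_mul, mul_one]
      rw [h]
      exact Submodule.smul_mem _ _ (hmon α)
    | add q r hq hr => rw [map_add]; exact add_mem hq hr
  intro f _
  -- `a / b = a b^{p-1} / b^p`, and `b^p` is a constant
  obtain ⟨a, b, hb, rfl⟩ := IsFractionRing.div_surjective (MvPolynomial ℕ k) f
  have hb0 : algebraMap _ (RatZ k) b ≠ 0 := by
    simpa using nonZeroDivisors.ne_zero hb
  have hbp : (algebraMap _ (RatZ k) b) ^ p ∈ zConst k := by
    rw [mem_zConst, Derivation.leibniz_pow]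
    have : CharP (RatZ k) p := charP_of_injective_algebraMap (algebraMap k (RatZ k)).injective p
    rw [← Nat.cast_smul_eq_nsmul (RatZ k), CharP.cast_eq_zero, zero_smul]
  have h : algebraMap _ (RatZ k) a / algebraMap _ (RatZ k) b =
      (⟨_, inv_mem_zConst hbp⟩ : zConst k) • algebraMap _ (RatZ k) (a * b ^ (p - 1)) := by
    rw [zConst_smul_def, map_mul, map_pow, div_eq_iff hb0]
    have hp : p = p - 1 + 1 := by have := (Fact.out : p.Prime).pos; omega
    have h2 : (algebraMap _ (RatZ k) b) ^ p =
        (algebraMap _ (RatZ k) b) ^ (p - 1) * algebraMap _ (RatZ k) b := by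
      conv_lhs => rw [hp]
      rw [pow_succ]
    simp only
    rw [h2]
    field_simp
  rw [h]
  exact Submodule.smul_mem _ _ (hpoly _)

/-- The monomials `z^{e^*}` form a basis of `k(z)` over its constants. -/
def wBasis (p : ℕ) [Fact p.Prime] (k : Type*) [Field k] [CharP k p] :
    Module.Basis ℕ (zConst k) (RatZ k) :=
  Module.Basis.mk (v := wMon p k) (by
    rw [linearIndependent_iff]
    intro l hl
    ext e
    rw [eq_zero_of_zD_pow_linearCombination (p := p) l (n := 0) (by simpa using hl)
      (Nat.zero_le e)]
    rfl) span_wMon_eq_top.ge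

theorem wBasis_apply (e : ℕ) : wBasis p k e = wMon p k e := Module.Basis.mk_apply _ _ _

theorem zD_pow_eq_zero_iff {f : RatZ k} {n : ℕ} :
    (zD k 0 ^ n) f = 0 ↔ ∀ e, n ≤ e → (wBasis p k).repr f e = 0 := by
  have hw : ⇑(wBasis p k) = wMon p k := funext wBasis_apply
  have hf := (wBasis p k).linearCombination_repr f
  rw [hw] at hf
  constructor
  · intro h e he
    exact eq_zero_of_zD_pow_linearCombination (p := p) _ (by rw [hf, h]) he
  · intro h
    rw [← hf, Finsupp.linearCombination_apply, Finsupp.sum, map_sum]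
    refine Finset.sum_eq_zero fun e he => ?_
    have h1 : e < n := by
      by_contra h2
      exact (Finsupp.mem_support_iff.1 he) (h e (not_lt.1 h2))
    rw [zConst_smul_def, zD_pow_const_mul 0 (Subtype.mem _), zD_pow_wMon_of_lt h1, mul_zero]

theorem exists_zD_pow_eq_zero (p : ℕ) [Fact p.Prime] [CharP k p] (f : RatZ k) :
    ∃ n, (zD k 0 ^ n) f = 0 := by
  obtain ⟨n, hn⟩ := ((wBasis p k).repr f).support.exists_nat_subset_range
  refine ⟨n, (zD_pow_eq_zero_iff (p := p)).2 fun e he => ?_⟩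
  by_contra h0
  have := Finset.mem_range.1 (hn (Finsupp.mem_support_iff.2 h0))
  omega

/-- The complement of the kernel of `(x ∂)^n` in `k(z)` that is spanned by the `z^{e^*}` with
`e ≥ n`. -/
def wUpper (p : ℕ) [Fact p.Prime] (k : Type*) [Field k] [CharP k p] (n : ℕ) :
    Submodule (zConst k) (RatZ k) where
  carrier := {f | ∀ e < n, (wBasis p k).repr f e = 0}
  zero_mem' e _ := by simp
  add_mem' {f g} hf hg e he := by simp [hf e he, hg e he]
  smul_mem' a f hf e he := by simp [hf e he]

theorem wMon_mem_wUpper {n e : ℕ} (h : n ≤ e) : wMon p k e ∈ wUpper p k n := fun i hi => by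
  rw [← wBasis_apply, Module.Basis.repr_self, Finsupp.single_eq_of_ne (by omega)]

theorem eq_zero_of_mem_wUpper {n : ℕ} {f : RatZ k} (hf : f ∈ wUpper p k n)
    (h : (zD k 0 ^ n) f = 0) : f = 0 := by
  apply (wBasis p k).repr.injective
  rw [map_zero]
  ext e
  rcases lt_or_ge e n with he | he
  · rw [hf e he]; rfl
  · rw [(zD_pow_eq_zero_iff (p := p)).1 h e he]; rfl

theorem exists_mem_wUpper_zD_pow_sub (n : ℕ) (f : RatZ k) :
    ∃ g ∈ wUpper p k n, (zD k 0 ^ n) (f - g) = 0 := by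
  refine ⟨(wBasis p k).repr.symm (((wBasis p k).repr f).filter fun e => n ≤ e), ?_, ?_⟩
  · intro e he
    rw [LinearEquiv.apply_symm_apply, Finsupp.filter_apply_neg _ _ (not_le.2 he)]
  · refine (zD_pow_eq_zero_iff (p := p)).2 fun e he => ?_
    rw [map_sub, LinearEquiv.apply_symm_apply, Finsupp.sub_apply,
      Finsupp.filter_apply_pos (fun e => n ≤ e) _ he, sub_self]

/-! ### The spaces spanned by floor chains -/

/-- The span of the monomials `z^α` with `α₁ < n` and `α_{j+1} ≤ α_j / p` for all `j`. -/
def chainSpan (p : ℕ) (k : Type*) [Field k] (n : ℕ) : Submodule k (RatZ k) :=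
  Submodule.span k (zMon k '' {α | α 0 < n ∧ IsFloorChain p α})

/-- The complement of the kernel of `(x ∂)^μ` in `chainSpan p k n`. -/
def chainUpper (p : ℕ) (k : Type*) [Field k] (n μ : ℕ) : Submodule k (RatZ k) :=
  Submodule.span k (zMon k '' {α | (α 0 < n ∧ IsFloorChain p α) ∧ μ ≤ eWeight p α})

omit [Fact p.Prime] [CharP k p] in
theorem chainUpper_le (n μ : ℕ) : chainUpper p k n μ ≤ chainSpan p k n :=
  Submodule.span_mono (Set.image_mono fun _ h => h.1)

omit [Fact p.Prime] [CharP k p] in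
theorem chainSpan_mono {m n : ℕ} (h : m ≤ n) : chainSpan p k m ≤ chainSpan p k n :=
  Submodule.span_mono (Set.image_mono fun _ hα => ⟨hα.1.trans_le h, hα.2⟩)

omit [Fact p.Prime] [CharP k p] in
theorem chainSpan_zero : chainSpan p k 0 = ⊥ := by simp [chainSpan]

theorem chainUpper_le_wUpper (n μ : ℕ) :
    chainUpper p k n μ ≤ (wUpper p k μ).restrictScalars k := by
  refine Submodule.span_le.2 ?_
  rintro _ ⟨α, ⟨-, hμ⟩, rfl⟩
  obtain ⟨a, ha, h⟩ := exists_zMon_eq_mul_wMon (p := p) (k := k) α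
  rw [h]
  exact Submodule.smul_mem (wUpper p k μ) (⟨a, ha⟩ : zConst k) (wMon_mem_wUpper hμ)

omit [CharP k p] in
theorem zMon_mul_wMon_mem_chainSpan {σ : ℕ →₀ ℕ} (hσ : IsFloorChain p σ) {i n : ℕ}
    (h : σ 0 + i < n) : zMon k σ * wMon p k i ∈ chainSpan p k n := by
  rw [wMon, ← zMon_add]
  refine Submodule.subset_span ⟨_, ⟨?_, hσ.add (isFloorChain_floorSeq i)⟩, rfl⟩
  simpa [floorSeq_apply] using h

omit [Fact p.Prime] [CharP k p] in
theorem zMon_mul_mem_chainSpan {σ : ℕ →₀ ℕ} (hσ : IsFloorChain p σ) {n : ℕ} {f : RatZ k}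
    (hf : f ∈ chainSpan p k n) : zMon k σ * f ∈ chainSpan p k (σ 0 + n) := by
  refine (Submodule.span_le.2 ?_ : chainSpan p k n ≤
    (chainSpan p k (σ 0 + n)).comap (LinearMap.mulLeft k (zMon k σ))) hf
  rintro _ ⟨α, ⟨h0, hα⟩, rfl⟩
  rw [SetLike.mem_coe, Submodule.mem_comap, LinearMap.mulLeft_apply, ← zMon_add]
  exact Submodule.subset_span ⟨_, ⟨by simpa using h0, hσ.add hα⟩, rfl⟩

/-- It suffices to check inclusions on the products `z^σ z^{i^*}` with `x ∂ z^σ = 0`. -/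
theorem chainSpan_le {n : ℕ} {V : Submodule k (RatZ k)}
    (h : ∀ (σ : ℕ →₀ ℕ) (i : ℕ), IsFloorChain p σ → zEuler k (zMon k σ) = 0 → σ 0 + i < n →
      zMon k σ * wMon p k i ∈ V) : chainSpan p k n ≤ V := by
  refine Submodule.span_le.2 ?_
  rintro _ ⟨α, ⟨h0, hα⟩, rfl⟩
  obtain ⟨σ, h1, h2, h3, -, h4⟩ := hα.exists_zMon_eq (k := k)
  rw [h4]
  exact h σ _ h1 h2 (by omega)

/-- The derivation `x ∂` lowers the bound on `α₁` by one. -/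
theorem chainSpan_le_comap_zD (n : ℕ) :
    chainSpan p k (n + 1) ≤ (chainSpan p k n).comap (zD k 0) := by
  refine chainSpan_le fun σ i hσ hd hi => ?_
  rw [Submodule.mem_comap, zD_const_mul 0 hd]
  cases i with
  | zero => simp [wMon_zero, zD_zero_apply]
  | succ i =>
    obtain ⟨c, -, hr⟩ := zEuler_wMon_succ (p := p) (k := k) i
    have h2 : zEuler k (wMon p k (i + 1)) ∈ chainSpan p k (i + 1) := by
      rw [← sub_add_cancel (zEuler k (wMon p k (i + 1))) (c • wMon p k i)]
      refine add_mem ((Submodule.span_le.2 ?_) hr) (Submodule.smul_mem _ _ ?_)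
      · rintro _ ⟨τ, j, hτ, -, h3, -, rfl⟩
        exact zMon_mul_wMon_mem_chainSpan hτ (by omega)
      · exact Submodule.subset_span
          ⟨_, ⟨by simp [floorSeq_apply], isFloorChain_floorSeq i⟩, rfl⟩
    rw [zD_zero_apply]
    exact chainSpan_mono (by omega) (zMon_mul_mem_chainSpan hσ h2)

/-- By induction on `e`, from the formula for the derivative of `z^{(e+1)^*}`: its further terms are
constant monomials times some `z^{i^*}` with `i < e`, for which preimages are known. -/
theorem wMon_mem_map_zD (e : ℕ) : wMon p k e ∈ (chainSpan p k (e + 2)).map (zD k 0) := by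
  induction e using Nat.strong_induction_on with
  | _ e ih =>
    obtain ⟨c, hc, hr⟩ := zEuler_wMon_succ (p := p) (k := k) e
    have h1 : zEuler k (wMon p k (e + 1)) ∈ (chainSpan p k (e + 2)).map (zD k 0) :=
      ⟨_, Submodule.subset_span ⟨_, ⟨by simp [floorSeq_apply], isFloorChain_floorSeq (e + 1)⟩,
        rfl⟩, zD_zero_apply _⟩
    have h2 : zEuler k (wMon p k (e + 1)) - c • wMon p k e ∈
        (chainSpan p k (e + 2)).map (zD k 0) := by
      refine Submodule.span_le.2 ?_ hr
      rintro _ ⟨σ, i, hσ, hd, h3, hi, rfl⟩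
      obtain ⟨v, hv, hvi⟩ := ih i hi
      refine ⟨zMon k σ * v, ?_, by rw [zD_const_mul 0 hd, hvi]⟩
      exact chainSpan_mono (by omega) (zMon_mul_mem_chainSpan hσ hv)
    have h3 := sub_mem h1 h2
    rw [sub_sub_cancel] at h3
    simpa [hc] using Submodule.smul_mem _ c⁻¹ h3

theorem chainSpan_le_map_zD (n : ℕ) :
    chainSpan p k n ≤ (chainSpan p k (n + 1)).map (zD k 0) := by
  refine chainSpan_le fun σ i hσ hd hi => ?_
  obtain ⟨v, hv, hvi⟩ := wMon_mem_map_zD (p := p) (k := k) i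
  exact ⟨zMon k σ * v, chainSpan_mono (by omega) (zMon_mul_mem_chainSpan hσ hv),
    by rw [zD_const_mul 0 hd, hvi]⟩

theorem zD_pow_mem_chainSpan {n μ : ℕ} {f : RatZ k} (hf : f ∈ chainSpan p k (n + μ)) :
    (zD k 0 ^ μ) f ∈ chainSpan p k n := by
  induction μ generalizing f with
  | zero => exact hf
  | succ μ ih =>
    rw [pow_succ, Module.End.mul_apply]
    exact ih (chainSpan_le_comap_zD _ hf)

theorem exists_zD_pow_eq_of_mem_chainSpan {n : ℕ} (μ : ℕ) {f : RatZ k}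
    (hf : f ∈ chainSpan p k n) : ∃ g ∈ chainSpan p k (n + μ), (zD k 0 ^ μ) g = f := by
  induction μ with
  | zero => exact ⟨f, hf, rfl⟩
  | succ μ ih =>
    obtain ⟨g, hg, h⟩ := ih
    obtain ⟨g', hg', h'⟩ := chainSpan_le_map_zD _ hg
    exact ⟨g', hg', by rw [pow_succ, Module.End.mul_apply, h', h]⟩

theorem zD_surjective (p : ℕ) [Fact p.Prime] [CharP k p] : Function.Surjective (zD k 0) := by
  intro f
  have h := span_wMon_eq_top (p := p) (k := k)
  have hf : f ∈ Submodule.span (zConst k) (Set.range (wMon p k)) := by rw [h]; trivial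
  induction hf using Submodule.span_induction with
  | mem x hx =>
    obtain ⟨e, rfl⟩ := hx
    obtain ⟨v, -, hv⟩ := wMon_mem_map_zD (p := p) (k := k) e
    exact ⟨v, hv⟩
  | zero => exact ⟨0, map_zero _⟩
  | add x y _ _ hx hy =>
    obtain ⟨a, rfl⟩ := hx
    obtain ⟨b, rfl⟩ := hy
    exact ⟨a + b, map_add _ _ _⟩
  | smul a x _ hx =>
    obtain ⟨b, rfl⟩ := hx
    exact ⟨a * b, zD_const_mul 0 a.2 b⟩

omit [Fact p.Prime] [CharP k p] in
theorem aeval_zD_mem {s : k} {V : Submodule k (RatZ k)} (hV : V ≤ V.comap (zD k 0))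
    (P : Polynomial k) {f : RatZ k} (hf : f ∈ V) : Polynomial.aeval (zD k s) P f ∈ V := by
  have h1 : ∀ g ∈ V, zD k s g ∈ V := fun g hg => by
    rw [zD_apply, ← zD_zero_apply]
    exact add_mem (hV hg) (Submodule.smul_mem _ _ hg)
  have h2 : ∀ n : ℕ, (zD k s ^ n) f ∈ V := fun n => by
    induction n with
    | zero => exact hf
    | succ n ih => rw [pow_succ', Module.End.mul_apply]; exact h1 _ ih
  rw [Polynomial.aeval_eq_sum_range, LinearMap.sum_apply]
  exact Submodule.sum_mem _ fun i _ => Submodule.smul_mem _ _ (h2 i)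

theorem chainSpan_le_comap (n : ℕ) : chainSpan p k n ≤ (chainSpan p k n).comap (zD k 0) :=
  (chainSpan_mono (Nat.le_succ n)).trans (chainSpan_le_comap_zD n)

/-! ### Polynomials in `x ∂` on `k(z)` -/

theorem aeval_zD_eq_pow_mul {P : Polynomial k} {s : k} {n : ℕ} {q : Polynomial k}
    (h : P = (Polynomial.X - Polynomial.C s) ^ n * q) (f : RatZ k) :
    Polynomial.aeval (zD k s) P f = (zD k 0 ^ n) (Polynomial.aeval (zD k s) q f) := by
  rw [h, map_mul, map_pow, aeval_zD_X_sub_C, Module.End.mul_apply]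

/-- If `s` is not a root of `q` then `q(x ∂ + s)` is locally invertible, with a polynomial in
`x ∂ + s` as inverse, because `x ∂` is locally nilpotent on `k(z)`. -/
theorem exists_aeval_zD_mul_eq (p : ℕ) [Fact p.Prime] [CharP k p] {s : k} {q : Polynomial k}
    (hq : ¬ (Polynomial.X - Polynomial.C s) ∣ q) (f : RatZ k) :
    ∃ a : Polynomial k, Polynomial.aeval (zD k s) (a * q) f = f := by
  obtain ⟨n, hn⟩ := exists_zD_pow_eq_zero p f
  have hcop : IsCoprime ((Polynomial.X - Polynomial.C s) ^ n) q :=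
    IsCoprime.pow_left ((Polynomial.irreducible_X_sub_C s).coprime_iff_not_dvd.2 hq)
  obtain ⟨a, b, hab⟩ := hcop
  refine ⟨b, ?_⟩
  have h1 := congrArg (fun P => Polynomial.aeval (zD k s) P f) hab
  simpa only [map_add, map_mul, map_pow, aeval_zD_X_sub_C, LinearMap.add_apply,
    Module.End.mul_apply, hn, map_zero, zero_add, map_one, Module.End.one_apply] using h1

theorem aeval_zD_eq_zero_iff (p : ℕ) [Fact p.Prime] [CharP k p] {P : Polynomial k} (hP : P ≠ 0)
    (s : k) (f : RatZ k) :
    Polynomial.aeval (zD k s) P f = 0 ↔ (zD k 0 ^ P.rootMultiplicity s) f = 0 := by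
  obtain ⟨q, hPq, hq⟩ := P.exists_eq_pow_rootMultiplicity_mul_and_not_dvd hP s
  rw [aeval_zD_eq_pow_mul hPq]
  have hcomm : (zD k 0 ^ P.rootMultiplicity s) (Polynomial.aeval (zD k s) q f) =
      Polynomial.aeval (zD k s) q ((zD k 0 ^ P.rootMultiplicity s) f) := by
    rw [← aeval_zD_X_sub_C s, ← map_pow, ← Module.End.mul_apply, ← Module.End.mul_apply,
      ← map_mul, ← map_mul, mul_comm]
  rw [hcomm]
  constructor
  · intro h
    obtain ⟨a, ha⟩ := exists_aeval_zD_mul_eq p hq ((zD k 0 ^ P.rootMultiplicity s) f)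
    rw [← ha, map_mul, Module.End.mul_apply, h, map_zero]
  · intro h
    rw [h, map_zero]

theorem aeval_zD_injOn_wUpper {P : Polynomial k} (hP : P ≠ 0) (s : k) :
    Set.InjOn (Polynomial.aeval (zD k s) P) (wUpper p k (P.rootMultiplicity s)) := by
  intro f hf g hg h
  rw [← sub_eq_zero]
  refine eq_zero_of_mem_wUpper (sub_mem hf hg) ?_
  rw [← aeval_zD_eq_zero_iff p hP, map_sub, sub_eq_zero]
  exact h

theorem exists_mem_wUpper_aeval_zD_eq {P : Polynomial k} (hP : P ≠ 0) (s : k) (g : RatZ k) :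
    ∃ f ∈ wUpper p k (P.rootMultiplicity s), Polynomial.aeval (zD k s) P f = g := by
  obtain ⟨q, hPq, hq⟩ := P.exists_eq_pow_rootMultiplicity_mul_and_not_dvd hP s
  have hsurj : ∀ n : ℕ, Function.Surjective (zD k 0 ^ n) := fun n => by
    rw [Module.End.coe_pow]
    exact (zD_surjective p).iterate n
  obtain ⟨v, hv⟩ := hsurj (P.rootMultiplicity s) g
  obtain ⟨a, ha⟩ := exists_aeval_zD_mul_eq p hq v
  obtain ⟨f, hf, hfv⟩ := exists_mem_wUpper_zD_pow_sub (p := p) (P.rootMultiplicity s)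
    (Polynomial.aeval (zD k s) a v)
  refine ⟨f, hf, ?_⟩
  rw [← aeval_zD_eq_zero_iff p hP, map_sub, sub_eq_zero] at hfv
  rw [← hfv, aeval_zD_eq_pow_mul hPq, ← Module.End.mul_apply _ _ v, ← map_mul, mul_comm, ha, hv]

theorem aeval_zD_mem_chainSpan {P : Polynomial k} (hP : P ≠ 0) (s : k) {n : ℕ} {f : RatZ k}
    (hf : f ∈ chainSpan p k (n + P.rootMultiplicity s)) :
    Polynomial.aeval (zD k s) P f ∈ chainSpan p k n := by
  obtain ⟨q, hPq, -⟩ := P.exists_eq_pow_rootMultiplicity_mul_and_not_dvd hP s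
  rw [aeval_zD_eq_pow_mul hPq]
  exact zD_pow_mem_chainSpan (aeval_zD_mem (chainSpan_le_comap _) q hf)

theorem exists_mem_chainUpper_zD_pow_sub {n : ℕ} (μ : ℕ) {f : RatZ k}
    (hf : f ∈ chainSpan p k n) : ∃ g ∈ chainUpper p k n μ, (zD k 0 ^ μ) (f - g) = 0 := by
  induction hf using Submodule.span_induction with
  | mem x hx =>
    obtain ⟨α, hα, rfl⟩ := hx
    by_cases h : μ ≤ eWeight p α
    · exact ⟨_, Submodule.subset_span ⟨α, ⟨hα, h⟩, rfl⟩, by simp⟩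
    · refine ⟨0, zero_mem _, ?_⟩
      obtain ⟨a, ha, h1⟩ := exists_zMon_eq_mul_wMon (p := p) (k := k) α
      rw [sub_zero, h1, zD_pow_const_mul 0 ha, zD_pow_wMon_of_lt (not_le.1 h), mul_zero]
  | zero => exact ⟨0, zero_mem _, by simp⟩
  | add x y _ _ hx hy =>
    obtain ⟨a, ha, hxa⟩ := hx
    obtain ⟨b, hb, hyb⟩ := hy
    exact ⟨a + b, add_mem ha hb, by rw [add_sub_add_comm, map_add, hxa, hyb, add_zero]⟩
  | smul c x _ hx =>
    obtain ⟨a, ha, hxa⟩ := hx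
    exact ⟨c • a, Submodule.smul_mem _ c ha, by rw [← smul_sub, map_smul, hxa, smul_zero]⟩

theorem exists_mem_chainUpper_aeval_zD_eq {P : Polynomial k} (hP : P ≠ 0) (s : k) {n : ℕ}
    {g : RatZ k} (hg : g ∈ chainSpan p k n) :
    ∃ f ∈ chainUpper p k (n + P.rootMultiplicity s) (P.rootMultiplicity s),
      Polynomial.aeval (zD k s) P f = g := by
  obtain ⟨q, hPq, hq⟩ := P.exists_eq_pow_rootMultiplicity_mul_and_not_dvd hP s
  obtain ⟨v, hv, hvg⟩ := exists_zD_pow_eq_of_mem_chainSpan (P.rootMultiplicity s) hg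
  obtain ⟨a, ha⟩ := exists_aeval_zD_mul_eq p hq v
  obtain ⟨f, hf, hfv⟩ := exists_mem_chainUpper_zD_pow_sub (P.rootMultiplicity s)
    (aeval_zD_mem (s := s) (chainSpan_le_comap _) a hv)
  refine ⟨f, hf, ?_⟩
  rw [← aeval_zD_eq_zero_iff p hP, map_sub, sub_eq_zero] at hfv
  rw [← hfv, aeval_zD_eq_pow_mul hPq, ← Module.End.mul_apply _ _ v, ← map_mul, mul_comm, ha,
    hvg]

end Coefficients

/-! ### Coefficients of elements of `R` -/

section Coeff

variable {k : Type*} [Field k]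

/-- The coefficient in `k(z)` of `t^ρ x^m`. -/
def cf (ρ : k) (m : ℤ) : EPC k →+ RatZ k where
  toFun y := (AddMonoidAlgebra.coeff (R := LaurentSeries (RatZ k)) (M := k) y ρ).coeff m
  map_zero' := rfl
  map_add' _ _ := rfl

theorem cf_ext {y w : EPC k} (h : ∀ ρ m, cf ρ m y = cf ρ m w) : y = w := by
  refine AddMonoidAlgebra.coeff_injective (Finsupp.ext fun ρ => HahnSeries.ext (funext fun m => ?_))
  exact h ρ m

open Classical in
theorem cf_tMul (ρ σ : k) (m : ℤ) (f : LaurentSeries (RatZ k)) :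
    cf ρ m (tMul σ f) = if σ = ρ then f.coeff m else 0 := by
  change (AddMonoidAlgebra.coeff (AddMonoidAlgebra.single σ f) ρ).coeff m = _
  rw [AddMonoidAlgebra.coeff_single, Finsupp.single_apply]
  split_ifs <;> rfl

theorem cf_tMul_self (ρ : k) (m : ℤ) (f : LaurentSeries (RatZ k)) :
    cf ρ m (tMul ρ f) = f.coeff m := by
  rw [cf_tMul, if_pos rfl]

theorem cf_tMul_of_ne {ρ σ : k} (h : σ ≠ ρ) (m : ℤ) (f : LaurentSeries (RatZ k)) :
    cf ρ m (tMul σ f) = 0 := by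
  rw [cf_tMul, if_neg h]

/-- An element of `R` has finitely many exponents of `t`, and its exponents of `x` are bounded
below. -/
theorem exists_cf_bound (y : EPC k) : ∃ (s : Finset k) (m₀ : ℤ),
    ∀ ρ m, cf ρ m y ≠ 0 → ρ ∈ s ∧ m₀ ≤ m := by
  set c := AddMonoidAlgebra.coeff (R := LaurentSeries (RatZ k)) (M := k) y with hc
  have hb : ∀ t : Finset k, ∃ m₀ : ℤ, ∀ ρ ∈ t, ∀ m, (c ρ).coeff m ≠ 0 → m₀ ≤ m := fun t => by
    classical
    induction t using Finset.induction_on with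
    | empty => exact ⟨0, by simp⟩
    | insert a t _ ih =>
      obtain ⟨m₀, h⟩ := ih
      refine ⟨min m₀ (c a).order, fun ρ hρ m hm => ?_⟩
      rcases Finset.mem_insert.1 hρ with rfl | hρ
      · exact (min_le_right _ _).trans (HahnSeries.order_le_of_coeff_ne_zero hm)
      · exact (min_le_left _ _).trans (h ρ hρ m hm)
  obtain ⟨m₀, h⟩ := hb c.support
  have hs : ∀ ρ m, cf ρ m y ≠ 0 → ρ ∈ c.support := fun ρ m hm =>
    Finsupp.mem_support_iff.2 fun h0 => hm (by
      change (c ρ).coeff m = 0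
      rw [h0]; rfl)
  exact ⟨c.support, m₀, fun ρ m hm => ⟨hs ρ m hm, h ρ (hs ρ m hm) m hm⟩⟩

theorem exists_cf_eq (g : k → ℤ → RatZ k) (s : Finset k) (m₀ : ℤ)
    (h : ∀ ρ m, g ρ m ≠ 0 → ρ ∈ s ∧ m₀ ≤ m) : ∃ y : EPC k, ∀ ρ m, cf ρ m y = g ρ m := by
  let c : k →₀ LaurentSeries (RatZ k) := Finsupp.onFinset s
    (fun ρ => HahnSeries.ofSuppBddBelow (g ρ) ⟨m₀, fun m hm => (h ρ m hm).2⟩) (fun ρ hρ => by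
      by_contra hs
      refine hρ (HahnSeries.ext (funext fun m => ?_))
      by_contra hm
      exact hs (h ρ m hm).1)
  exact ⟨(AddMonoidAlgebra.ofCoeff c : EPCAlg k), fun ρ m => rfl⟩

theorem cf_eq_zero_of_lt_of_bound {y : EPC k} {s : Finset k} {m₀ : ℤ}
    (h : ∀ ρ m, cf ρ m y ≠ 0 → ρ ∈ s ∧ m₀ ≤ m) {ρ : k} {m : ℤ} (hm : m < m₀) : cf ρ m y = 0 := by
  by_contra h0
  exact absurd (h ρ m h0).2 (not_le.2 hm)

theorem epc_induction {motive : EPC k → Prop} (y : EPC k) (zero : motive 0)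
    (add : ∀ y w, motive y → motive w → motive (y + w)) (tmul : ∀ ρ f, motive (tMul ρ f)) :
    motive y :=
  AddMonoidAlgebra.induction_linear (motive := motive) y zero add tmul

theorem tMul_mul_tMul (ρ σ : k) (f g : LaurentSeries (RatZ k)) :
    tMul ρ f * tMul σ g = tMul (ρ + σ) (f * g) :=
  AddMonoidAlgebra.single_mul_single ..

theorem cf_tMul_mul (ρ σ : k) (m : ℤ) (f : LaurentSeries (RatZ k)) (b : ℤ) (a : RatZ k)
    (hf : f = HahnSeries.single b a) (y : EPC k) :
    cf ρ m (tMul σ f * y) = a * cf (ρ - σ) (m - b) y := by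
  subst hf
  induction y using epc_induction with
  | zero => simp
  | add y w hy hw => rw [mul_add, map_add, hy, hw, map_add, mul_add]
  | tmul τ g =>
    rw [tMul_mul_tMul, cf_tMul, cf_tMul]
    by_cases h : σ + τ = ρ
    · rw [if_pos h, if_pos (by rw [← h]; ring), mul_comm, HahnSeries.coeff_mul_single, mul_comm]
    · rw [if_neg h, if_neg (fun h' => h (by rw [h']; ring)), mul_zero]

theorem cf_xPow_mul (ρ : k) (m n : ℤ) (y : EPC k) : cf ρ m (xPow k n * y) = cf ρ (m - n) y := by
  rw [xPow, cf_tMul_mul ρ 0 m _ n 1 rfl, one_mul, sub_zero]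

theorem cf_mul_mem (c y : EPC k) (σ : k) (n : ℤ) (V : AddSubmonoid (RatZ k))
    (h : ∀ ρ i, cf ρ i c * cf (σ - ρ) (n - i) y ∈ V) : cf σ n (c * y) ∈ V := by
  classical
  have e : cf σ n (c * y) = _ := congrArg (HahnSeries.coeff · n)
    (AddMonoidAlgebra.coeff_mul (R := LaurentSeries (RatZ k)) (M := k) c y σ)
  rw [e, Finsupp.sum, HahnSeries.coeff_sum]
  refine AddSubmonoid.sum_mem _ fun ρ _ => ?_
  rw [Finsupp.sum, HahnSeries.coeff_sum]
  refine AddSubmonoid.sum_mem _ fun τ _ => ?_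
  split_ifs with hτ
  · rw [HahnSeries.coeff_mul]
    refine AddSubmonoid.sum_mem _ fun ij hij => ?_
    have h1 : ij.1 + ij.2 = n := (Finset.mem_antidiagonal.1 hij).2.2
    have h2 := h ρ ij.1
    rw [← h1, ← hτ, add_sub_cancel_left, add_sub_cancel_left] at h2
    exact h2
  · exact zero_mem _

theorem cf_euler (ρ : k) (m : ℤ) (y : EPC k) :
    cf ρ m (euler k y) = zD k (ρ + m) (cf ρ m y) := by
  induction y using epc_induction with
  | zero => simp
  | add y w hy hw => rw [map_add, map_add, hy, hw, map_add, map_add]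
  | tmul σ f =>
    rw [euler_tMul, cf_tMul, cf_tMul]
    split_ifs with h
    · subst h
      have h1 : (laurentEuler (zEuler k) f).coeff m = zEuler k (f.coeff m) + m * f.coeff m := rfl
      rw [HahnSeries.coeff_add, h1, HahnSeries.C_apply, HahnSeries.coeff_single_zero_mul, zD_apply,
        add_smul, Algebra.smul_def, Algebra.smul_def, map_intCast]
      ring
    · rw [map_zero]

theorem cf_der (ρ : k) (m : ℤ) (y : EPC k) :
    cf ρ m (der k y) = zD k (ρ + (m + 1 : ℤ)) (cf ρ (m + 1) y) := by
  change cf ρ m (xPow k (-1) * euler k y) = _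
  rw [cf_xPow_mul, cf_euler, sub_neg_eq_add]

/-- `x^j ∂^j = δ (δ - 1) ⋯ (δ - j + 1)` for `δ = x ∂`. -/
theorem cf_der_iterate (j : ℕ) (ρ : k) (m : ℤ) (y : EPC k) :
    cf ρ m ((der k)^[j] y) =
      Polynomial.aeval (zD k (ρ + (m + j : ℤ))) (descPochhammer k j) (cf ρ (m + j) y) := by
  induction j generalizing m with
  | zero => simp
  | succ j ih =>
    rw [Function.iterate_succ_apply', cf_der, ih, descPochhammer_succ_right, mul_comm]
    have e : m + 1 + (j : ℤ) = m + ((j + 1 : ℕ) : ℤ) := by push_cast; ring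
    rw [e, map_mul, Module.End.mul_apply]
    congr 1
    have h : ∀ s : k, Polynomial.aeval (zD k (s + j)) (Polynomial.X - (j : Polynomial k)) =
        zD k s := fun s => by
      ext f
      simp [zD_apply, add_smul, Module.End.natCast_apply, Nat.cast_smul_eq_nsmul, ← add_assoc]
    rw [← h]
    congr 3
    push_cast
    ring

theorem ofSeries_apply (a : PowerSeries k) : ofSeries k a = tMul 0
    (HahnSeries.ofPowerSeries ℤ (RatZ k) (PowerSeries.map (algebraMap k (RatZ k)) a)) := rfl

theorem cf_ofSeries_of_neg (a : PowerSeries k) (ρ : k) {m : ℤ} (hm : m < 0) :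
    cf ρ m (ofSeries k a) = 0 := by
  rw [ofSeries_apply, cf_tMul]
  split_ifs
  · rw [HahnSeries.ofPowerSeries_apply]
    refine HahnSeries.embDomain_of_notMem_range ?_
    rintro ⟨n, rfl⟩
    simp at hm
    omega
  · rfl

theorem cf_ofSeries_of_ne (a : PowerSeries k) {ρ : k} (hρ : ρ ≠ 0) (m : ℤ) :
    cf ρ m (ofSeries k a) = 0 := by
  rw [ofSeries_apply, cf_tMul_of_ne hρ.symm]

theorem cf_ofSeries_natCast (a : PowerSeries k) (n : ℕ) :
    cf 0 (n : ℤ) (ofSeries k a) = algebraMap k (RatZ k) (PowerSeries.coeff n a) := by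
  rw [ofSeries_apply, cf_tMul_self, HahnSeries.ofPowerSeries_apply_coeff, PowerSeries.coeff_map]

theorem ofSeries_monomial (j : ℕ) (c : k) : ofSeries k (PowerSeries.monomial j c) =
    tMul 0 (HahnSeries.single (j : ℤ) (algebraMap k (RatZ k) c)) := by
  have h : PowerSeries.monomial j c = PowerSeries.C c * PowerSeries.X ^ j := by
    ext n
    simp [PowerSeries.coeff_X_pow, PowerSeries.coeff_monomial]
  rw [ofSeries_apply, h, map_mul, map_mul, map_pow, PowerSeries.map_X, PowerSeries.map_C,
    HahnSeries.ofPowerSeries_C, HahnSeries.ofPowerSeries_X_pow, HahnSeries.C_apply,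
    HahnSeries.single_mul_single, zero_add, mul_one]

/-- Multiplication by power series preserves conditions on the coefficients given by an increasing
sequence of subspaces. -/
theorem cf_ofSeries_mul_mem {W : ℤ → Submodule k (RatZ k)} (hW : Monotone W) (a : PowerSeries k)
    {y : EPC k} {ρ : k} (hy : ∀ m, cf ρ m y ∈ W m) (m : ℤ) :
    cf ρ m (ofSeries k a * y) ∈ W m := by
  refine cf_mul_mem _ _ _ _ (W m).toAddSubmonoid fun σ i => ?_
  change _ ∈ W m
  by_cases hσ : σ = 0
  · subst hσ
    rcases lt_or_ge i 0 with hi | hi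
    · rw [cf_ofSeries_of_neg _ _ hi, zero_mul]; exact zero_mem _
    · lift i to ℕ using hi
      rw [cf_ofSeries_natCast, sub_zero, ← Algebra.smul_def]
      exact Submodule.smul_mem _ _ (hW (by omega) (hy _))
  · rw [cf_ofSeries_of_ne _ hσ, zero_mul]; exact zero_mem _

end Coeff

/-! ### The field of constants -/

section Constants

variable {k : Type*} [Field k]

theorem isUnit_xPow (n : ℤ) : IsUnit (xPow k n) := by
  refine IsUnit.of_mul_eq_one (xPow k (-n)) (cf_ext fun ρ m => ?_)
  rw [cf_xPow_mul, xPow, cf_tMul]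
  have h : (1 : EPC k) = tMul 0 1 := rfl
  rw [h, cf_tMul]
  split_ifs
  · rw [HahnSeries.coeff_single, HahnSeries.coeff_one]
    congr 1
    simp only [eq_iff_iff]
    omega
  · rfl

/-- A constant of `R` is supported in the terms `t^ρ x^m` with `ρ + m = 0` in `k`, and its
coefficients are constants of `k(z)`. -/
theorem mem_constants_iff (p : ℕ) [Fact p.Prime] [CharP k p] {c : EPC k} : c ∈ constants k ↔
    ∀ ρ (m : ℤ), cf ρ m c ∈ zConst k ∧ (ρ + (m : k) ≠ 0 → cf ρ m c = 0) := by
  have h1 : c ∈ constants k ↔ ∀ ρ (m : ℤ), zD k (ρ + m) (cf ρ m c) = 0 := by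
    change der k c = 0 ↔ _
    constructor
    · intro h ρ m
      have h2 := cf_der ρ (m - 1) c
      rw [h, map_zero, sub_add_cancel] at h2
      exact h2.symm
    · intro h
      refine cf_ext fun ρ m => ?_
      rw [cf_der, h, map_zero]
  rw [h1]
  refine forall₂_congr fun ρ m => ?_
  by_cases h0 : ρ + (m : k) = 0
  · simp [h0, zD_zero_apply, mem_zConst]
  · refine ⟨fun h => ?_, fun h => by rw [h.2 h0, map_zero]⟩
    have hX := aeval_zD_eq_zero_iff p (Polynomial.X_ne_zero (R := k)) (ρ + m) (cf ρ m c)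
    rw [Polynomial.rootMultiplicity_eq_zero (by simpa using h0), Polynomial.aeval_X] at hX
    have h2 : cf ρ m c = 0 := hX.1 h
    exact ⟨by rw [h2]; exact zero_mem _, fun _ => h2⟩

/-- The ring homomorphism `R → k(z)((x))` with `t^ρ ↦ 1`. -/
def augment (k : Type*) [Field k] : EPC k →+* LaurentSeries (RatZ k) :=
  (AddMonoidAlgebra.liftNCRingHom (RingHom.id (LaurentSeries (RatZ k)))
    (1 : Multiplicative k →* LaurentSeries (RatZ k)) (fun _ _ => Commute.all _ _) :
    EPCAlg k →+* LaurentSeries (RatZ k))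

theorem augment_tMul (ρ : k) (f : LaurentSeries (RatZ k)) : augment k (tMul ρ f) = f := by
  change AddMonoidAlgebra.liftNCRingHom _ _ _ (AddMonoidAlgebra.single ρ f) = _
  simp

theorem augment_eq_sum (y : EPC k) : augment k y =
    (AddMonoidAlgebra.coeff (R := LaurentSeries (RatZ k)) (M := k) y).sum fun _ f => f := by
  induction y using epc_induction with
  | zero => simp; rfl
  | add y w hy hw =>
    rw [map_add, hy, hw]
    exact (Finsupp.sum_add_index' (fun _ => rfl) fun _ _ _ => rfl).symm
  | tmul ρ f =>
    rw [augment_tMul]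
    exact (Finsupp.sum_single_index (h := fun _ f => f) rfl).symm

/-- In a constant of `R` the exponent of `x` determines that of `t`, so no terms are merged by
`t^ρ ↦ 1`. -/
theorem augment_coeff (p : ℕ) [Fact p.Prime] [CharP k p] {c : EPC k} (hc : c ∈ constants k)
    (m : ℤ) :
    (augment k c).coeff m = cf (-(m : k)) m c := by
  rw [augment_eq_sum, Finsupp.sum, HahnSeries.coeff_sum]
  refine Finset.sum_eq_single (-(m : k)) (fun ρ _ hρ => ?_) fun h => ?_
  · exact ((mem_constants_iff p).1 hc ρ m).2 fun h => hρ (eq_neg_of_add_eq_zero_left h)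
  · rw [Finsupp.notMem_support_iff.1 h]; rfl

instance : Nontrivial (EPC k) := inferInstanceAs (Nontrivial (EPCAlg k))

theorem charP_epc (p : ℕ) [CharP k p] : CharP (EPC k) p :=
  charP_of_injective_ringHom (((ofSeries k).comp PowerSeries.C).injective) p

variable {p : ℕ} [Fact p.Prime] [CharP k p]

/-- The Frobenius map of `R` factors through `t^ρ ↦ 1`. -/
theorem pow_char_eq (y : EPC k) : y ^ p = tMul 0 (augment k y ^ p) := by
  have := charP_epc (k := k) p
  have hF : CharP (LaurentSeries (RatZ k)) p :=
    charP_of_injective_ringHom ((augment k).comp ((ofSeries k).comp PowerSeries.C)).injective p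
  have hpow : ∀ (f : LaurentSeries (RatZ k)) (ρ : k) (n : ℕ),
      tMul ρ f ^ n = tMul (n * ρ) (f ^ n) := fun f ρ n => by
    induction n with
    | zero => simp; rfl
    | succ n ih =>
      rw [pow_succ, ih, tMul_mul_tMul, ← pow_succ]
      congr 1
      push_cast
      ring
  induction y using epc_induction with
  | zero =>
    rw [map_zero, zero_pow (Fact.out : p.Prime).ne_zero, zero_pow (Fact.out : p.Prime).ne_zero]
    exact (AddMonoidAlgebra.single_zero (R := LaurentSeries (RatZ k)) (0 : k)).symm
  | add y w hy hw =>
    rw [add_pow_char, hy, hw, map_add, add_pow_char]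
    exact (AddMonoidAlgebra.single_add (R := LaurentSeries (RatZ k)) ..).symm
  | tmul ρ f => rw [augment_tMul, hpow, CharP.cast_eq_zero, zero_mul]

theorem isField_constants (p : ℕ) [Fact p.Prime] [CharP k p] : IsField (constants k) := by
  refine ⟨⟨0, 1, zero_ne_one⟩, mul_comm, fun {c} hc => ?_⟩
  have haug : augment k (c : EPC k) ≠ 0 := by
    intro h
    refine hc (Subtype.ext (cf_ext fun ρ m => ?_))
    by_cases hρ : ρ + (m : k) = 0
    · rw [eq_neg_of_add_eq_zero_left hρ, ← augment_coeff p c.2, h]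
      simp
    · rw [((mem_constants_iff p).1 c.2 ρ m).2 hρ]
      simp
  -- `c ^ p` lies in the field `k(z)((x))`, so `c` is a unit of `R`
  have hp : p = p - 1 + 1 := by have := (Fact.out : p.Prime).pos; omega
  have hinv : (c : EPC k) * ((c : EPC k) ^ (p - 1) * tMul 0 (augment k c ^ p)⁻¹) = 1 := by
    rw [← mul_assoc, ← pow_succ', ← hp, pow_char_eq, tMul_mul_tMul,
      mul_inv_cancel₀ (pow_ne_zero _ haug), add_zero]
    rfl
  refine ⟨⟨_, ?_⟩, Subtype.ext hinv⟩
  set d := (c : EPC k) ^ (p - 1) * tMul 0 (augment k c ^ p)⁻¹ with hd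
  have h1 := der_mul (c : EPC k) d
  have h2 : der k (1 : EPC k) = 0 := (constants k).one_mem
  rw [hinv, h2, show der k (c : EPC k) = 0 from c.2, zero_mul, add_zero] at h1
  exact (IsUnit.of_mul_eq_one _ hinv).mul_right_eq_zero.1 h1.symm

end Constants

/-! ### The action of differential operators -/

namespace DiffOp

variable {k : Type*} [Field k]

theorem act_eq_sum (L : DiffOp k) {s : Finset ℕ} (hs : L.support ⊆ s) (y : EPC k) :
    L.act y = ∑ j ∈ s, ofSeries k (L j) * (der k)^[j] y :=
  Finsupp.sum_of_support_subset _ hs _ (by simp)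

theorem act_add (L : DiffOp k) (y w : EPC k) : L.act (y + w) = L.act y + L.act w := by
  simp [act, Finsupp.sum, mul_add, Finset.sum_add_distrib]

theorem act_const_mul (L : DiffOp k) {c : EPC k} (hc : c ∈ constants k) (y : EPC k) :
    L.act (c * y) = c * L.act y := by
  simp only [act, Finsupp.sum, der_iterate_mul (show der k c = 0 from hc),
    mul_left_comm _ c, Finset.mul_sum]

theorem bddBelow_shift (L : DiffOp k) :
    BddBelow {m : ℤ | ∃ i j : ℕ, PowerSeries.coeff i (L j) ≠ 0 ∧ m = (i : ℤ) - j} := by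
  refine ⟨-(L.order : ℤ), ?_⟩
  rintro _ ⟨i, j, hij, rfl⟩
  have hj : j ∈ L.support := Finsupp.mem_support_iff.2 fun h => hij (by rw [h, map_zero])
  have : j ≤ L.order := Finset.le_sup (f := id) hj
  omega

theorem shift_le {L : DiffOp k} {i j : ℕ} (h : PowerSeries.coeff i (L j) ≠ 0) :
    L.shift ≤ (i : ℤ) - j :=
  csInf_le L.bddBelow_shift ⟨i, j, h, rfl⟩

theorem exists_coeff_ne_zero_shift {L : DiffOp k} (hL : L ≠ 0) :
    ∃ i j : ℕ, PowerSeries.coeff i (L j) ≠ 0 ∧ L.shift = (i : ℤ) - j := by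
  have hne : {m : ℤ | ∃ i j : ℕ, PowerSeries.coeff i (L j) ≠ 0 ∧ m = (i : ℤ) - j}.Nonempty := by
    obtain ⟨j, hj⟩ := Finsupp.ne_iff.1 hL
    obtain ⟨i, hi⟩ : ∃ i, PowerSeries.coeff i (L j) ≠ 0 := by
      by_contra! h
      exact hj (PowerSeries.ext h)
    exact ⟨_, i, j, hi, rfl⟩
  exact Int.csInf_mem hne L.bddBelow_shift

theorem coeff_normalize (L : DiffOp k) (i j : ℕ) : PowerSeries.coeff i (L.normalize j) =
    if 0 ≤ (i : ℤ) + L.shift then PowerSeries.coeff ((i : ℤ) + L.shift).toNat (L j) else 0 := by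
  rw [normalize, Finsupp.mapRange_apply, PowerSeries.coeff_mk]

theorem le_of_coeff_normalize_ne_zero {L : DiffOp k} {i j : ℕ}
    (h : PowerSeries.coeff i (L.normalize j) ≠ 0) : j ≤ i := by
  rw [coeff_normalize] at h
  split_ifs at h with h0
  · have := shift_le h
    omega
  · exact absurd rfl h

theorem shift_normalize {L : DiffOp k} (hL : L ≠ 0) : L.normalize.shift = 0 := by
  obtain ⟨i, j, h, hs⟩ := exists_coeff_ne_zero_shift hL
  have h1 : PowerSeries.coeff j (L.normalize j) ≠ 0 := by
    rw [coeff_normalize, if_pos (by omega), show ((j : ℤ) + L.shift).toNat = i by omega]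
    exact h
  have h2 := shift_le h1
  rw [sub_self] at h2
  refine le_antisymm h2 (le_csInf ⟨_, j, j, h1, rfl⟩ ?_)
  rintro _ ⟨i', j', h', rfl⟩
  have := le_of_coeff_normalize_ne_zero h'
  omega

theorem coeff_initialForm (L : DiffOp k) (i j : ℕ) : PowerSeries.coeff i (L.initialForm j) =
    if (i : ℤ) - j = L.shift then PowerSeries.coeff i (L j) else 0 := by
  rw [initialForm, Finsupp.onFinset_apply, PowerSeries.coeff_mk]

theorem initialForm_normalize_apply {L : DiffOp k} (hL : L ≠ 0) (j : ℕ) :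
    L.normalize.initialForm j =
      PowerSeries.monomial j (PowerSeries.coeff j (L.normalize j)) := by
  ext i
  rw [coeff_initialForm, PowerSeries.coeff_monomial, shift_normalize hL]
  by_cases h : i = j
  · subst h; simp
  · rw [if_neg h, if_neg (by omega)]

/-- `L = x^τ M`. -/
theorem act_eq_xPow_mul (L : DiffOp k) (y : EPC k) :
    L.act y = xPow k L.shift * L.normalize.act y := by
  rw [L.normalize.act_eq_sum (Finsupp.support_mapRange (hf := by ext i; simp)), Finset.mul_sum,
    L.act_eq_sum (Finset.Subset.refl _)]
  refine Finset.sum_congr rfl fun j _ => ?_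
  rw [← mul_assoc]
  congr 1
  refine cf_ext fun ρ m => ?_
  rw [cf_xPow_mul]
  by_cases hρ : ρ = 0
  · subst hρ
    rcases lt_or_ge m 0 with hm | hm
    · rw [cf_ofSeries_of_neg _ _ hm]
      rcases lt_or_ge (m - L.shift) 0 with hm' | hm'
      · rw [cf_ofSeries_of_neg _ _ hm']
      · obtain ⟨i, hi⟩ := Int.eq_ofNat_of_zero_le hm'
        rw [hi, cf_ofSeries_natCast, coeff_normalize, if_neg (by omega), map_zero]
    · obtain ⟨n, rfl⟩ := Int.eq_ofNat_of_zero_le hm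
      rw [cf_ofSeries_natCast]
      rcases lt_or_ge ((n : ℤ) - L.shift) 0 with hm' | hm'
      · rw [cf_ofSeries_of_neg _ _ hm']
        by_cases h : PowerSeries.coeff n (L j) = 0
        · rw [h, map_zero]
        · -- a coefficient below the shift would contradict its minimality
          have := shift_le h
          omega
      · obtain ⟨i, hi⟩ := Int.eq_ofNat_of_zero_le hm'
        rw [hi, cf_ofSeries_natCast, coeff_normalize, if_pos (by omega),
          show ((i : ℤ) + L.shift).toNat = n by omega]
  · rw [cf_ofSeries_of_ne _ hρ, cf_ofSeries_of_ne _ hρ]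

theorem act_eq_zero_iff (L : DiffOp k) (y : EPC k) : L.act y = 0 ↔ L.normalize.act y = 0 := by
  rw [act_eq_xPow_mul, (isUnit_xPow L.shift).mul_right_eq_zero]

theorem support_initialForm_subset (L : DiffOp k) : L.initialForm.support ⊆ L.support :=
  Finsupp.support_onFinset_subset

/-- `L₀` acts on the coefficient of `t^ρ x^m` as `χ(x ∂ + ρ + m)`. -/
theorem cf_actInitial {L : DiffOp k} (hL : L ≠ 0) (ρ : k) (m : ℤ) (y : EPC k) :
    cf ρ m (L.actInitial y) = Polynomial.aeval (zD k (ρ + m)) L.indicial (cf ρ m y) := by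
  rw [actInitial, act_eq_sum _ (support_initialForm_subset _), map_sum, indicial, Finsupp.sum,
    map_sum, LinearMap.sum_apply]
  refine Finset.sum_congr rfl fun j _ => ?_
  rw [initialForm_normalize_apply hL, ofSeries_monomial, cf_tMul_mul ρ 0 m _ j _ rfl,
    cf_der_iterate, sub_zero, sub_add_cancel, ← Algebra.smul_def, map_mul, Polynomial.aeval_C,
    Module.End.mul_apply, Module.algebraMap_end_apply]

/-- `T = L₀ - M` shifts filtrations by stable subspaces by one. -/
theorem cf_actT_mem {L : DiffOp k} (hL : L ≠ 0) {W : ℤ → Submodule k (RatZ k)} (hW : Monotone W)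
    (hD : ∀ m, W m ≤ (W m).comap (zD k 0)) {y : EPC k} {ρ : k} (hy : ∀ m, cf ρ m y ∈ W m)
    (m : ℤ) : cf ρ m (L.actT y) ∈ W (m - 1) := by
  rw [actT, actInitial, act_eq_sum _ (support_initialForm_subset _),
    act_eq_sum L.normalize (Finset.Subset.refl _), ← Finset.sum_sub_distrib, map_sum]
  refine Submodule.sum_mem _ fun j _ => ?_
  rw [← sub_mul, ← map_sub, initialForm_normalize_apply hL]
  -- the coefficient of `∂ ^ j` in `T` is divisible by `x ^ (j + 1)`
  obtain ⟨b, hb⟩ : (PowerSeries.X : PowerSeries k) ^ (j + 1) ∣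
      PowerSeries.monomial j (PowerSeries.coeff j (L.normalize j)) - L.normalize j := by
    refine PowerSeries.X_pow_dvd_iff.2 fun i hi => ?_
    rw [map_sub, PowerSeries.coeff_monomial]
    split_ifs with h
    · rw [h, sub_self]
    · by_contra h0
      rw [zero_sub, neg_eq_zero] at h0
      have := le_of_coeff_normalize_ne_zero h0
      omega
  have hX : ofSeries k (PowerSeries.X ^ (j + 1)) = xPow k ((j + 1 : ℕ) : ℤ) := by
    rw [PowerSeries.X_pow_eq, ofSeries_monomial, map_one, xPow]
  rw [hb, mul_comm (PowerSeries.X ^ (j + 1)), map_mul (ofSeries k), hX, mul_assoc]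
  refine cf_ofSeries_mul_mem (W := fun n => W (n - 1)) (fun a b h => hW (by omega)) b
    (fun n => ?_) m
  rw [cf_xPow_mul, cf_der_iterate, show n - ((j + 1 : ℕ) : ℤ) + j = n - 1 by push_cast; ring]
  exact aeval_zD_mem (hD _) _ (hy _)

theorem IsRegularSingular.coeff_normalize_order_ne_zero {L : DiffOp k}
    (hL : L.IsRegularSingular) : PowerSeries.coeff L.order (L.normalize L.order) ≠ 0 := by
  obtain ⟨i, j, hij, hs⟩ := exists_coeff_ne_zero_shift hL.1
  have hne : L.initialForm.support.Nonempty := ⟨j, Finsupp.mem_support_iff.2 fun h => by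
    have h1 := L.coeff_initialForm i j
    rw [h, map_zero, if_pos hs.symm] at h1
    exact hij h1.symm⟩
  obtain ⟨n, hn, hsup⟩ := Finset.exists_mem_eq_sup _ hne id
  have hno : n = L.order := hsup.symm.trans hL.2
  rw [hno] at hn
  obtain ⟨l, hl⟩ : ∃ l, PowerSeries.coeff l (L.initialForm L.order) ≠ 0 := by
    by_contra! h
    exact Finsupp.mem_support_iff.1 hn (PowerSeries.ext h)
  rw [coeff_initialForm] at hl
  split_ifs at hl with h
  · rw [coeff_normalize, if_pos (by omega),
      show ((L.order : ℤ) + L.shift).toNat = l by omega]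
    exact hl
  · exact absurd rfl hl

theorem IsRegularSingular.natDegree_indicial {L : DiffOp k} (hL : L.IsRegularSingular) :
    L.indicial.natDegree = L.order ∧ L.indicial ≠ 0 := by
  have hsub : L.normalize.support ⊆ Finset.range (L.order + 1) := fun j hj => by
    have h1 : j ∈ L.support := Finsupp.support_mapRange (hf := by ext i; simp) hj
    exact Finset.mem_range.2 (Nat.lt_succ_of_le (Finset.le_sup (f := id) h1))
  have h1 : L.indicial = ∑ j ∈ Finset.range (L.order + 1),
      Polynomial.C (PowerSeries.coeff j (L.normalize j)) * descPochhammer k j :=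
    Finsupp.sum_of_support_subset _ hsub _ (by simp)
  have h2 : L.indicial.coeff L.order ≠ 0 := by
    rw [h1, Polynomial.finsetSum_coeff, Finset.sum_range_succ, Finset.sum_eq_zero, zero_add,
      Polynomial.coeff_C_mul]
    · have h3 := monic_descPochhammer k L.order
      rw [Polynomial.Monic, Polynomial.leadingCoeff, descPochhammer_natDegree] at h3
      rw [h3, mul_one]
      exact hL.coeff_normalize_order_ne_zero
    · intro j hj
      rw [Polynomial.coeff_C_mul, Polynomial.coeff_eq_zero_of_natDegree_lt, mul_zero]
      rw [descPochhammer_natDegree]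
      exact Finset.mem_range.1 hj
  refine ⟨Polynomial.natDegree_eq_of_le_of_coeff_ne_zero ?_ h2, fun h => h2 (by rw [h]; simp)⟩
  rw [h1]
  refine Polynomial.natDegree_sum_le_of_forall_le _ _ fun j hj => ?_
  refine (Polynomial.natDegree_C_mul_le _ _).trans ?_
  rw [descPochhammer_natDegree]
  exact Nat.lt_succ_iff.1 (Finset.mem_range.1 hj)

end DiffOp

/-! ### Inverting operators that raise the order in `x` -/

section Geometric

variable {k : Type*} [Field k] {N : EPC k →+ EPC k}

/-- An operator that raises the order in `x` has no nonzero fixed points. -/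
theorem eq_zero_of_eq_apply
    (hN : ∀ y ρ m, (∀ m' < m, cf ρ m' y = 0) → cf ρ m (N y) = 0) {y : EPC k} (hy : y = N y) :
    y = 0 := by
  obtain ⟨s, m₀, hb⟩ := exists_cf_bound y
  refine cf_ext fun ρ m => ?_
  rw [map_zero]
  have key : ∀ n : ℕ, ∀ m, m < m₀ + n → cf ρ m y = 0 := fun n => by
    induction n with
    | zero => exact fun m hm => cf_eq_zero_of_lt_of_bound hb (by simpa using hm)
    | succ n ih =>
      intro m hm
      rw [hy]
      exact hN y ρ m fun m' hm' => ih m' (by push_cast at hm; omega)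
  exact key (m - m₀ + 1).toNat m (by omega)

/-- The equation `y - N y = g` is solved by `∑ N ^ i g`, which converges coefficientwise. -/
theorem exists_sub_apply_eq
    (hN : ∀ y ρ m, (∀ m' < m, cf ρ m' y = 0) → cf ρ m (N y) = 0) (g : EPC k) :
    ∃ y, y - N y = g ∧
      ∀ ρ m, ∃ n : ℕ, cf ρ m y = cf ρ m (∑ i ∈ Finset.range n, N^[i] g) := by
  obtain ⟨s, m₀, hb⟩ := exists_cf_bound g
  have hlow : ∀ (i : ℕ) ρ m, m < m₀ + i → cf ρ m (N^[i] g) = 0 := fun i => by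
    induction i with
    | zero => exact fun ρ m hm => cf_eq_zero_of_lt_of_bound hb (by simpa using hm)
    | succ i ih =>
      intro ρ m hm
      rw [Function.iterate_succ_apply']
      exact hN _ ρ m fun m' hm' => ih ρ m' (by push_cast at hm; omega)
  have hsupp : ∀ (i : ℕ) ρ, ρ ∉ s → ∀ m, cf ρ m (N^[i] g) = 0 := fun i => by
    induction i with
    | zero =>
      intro ρ hρ m
      by_contra h
      exact hρ (hb ρ m h).1
    | succ i ih =>
      intro ρ hρ m
      rw [Function.iterate_succ_apply']
      exact hN _ ρ m fun m' _ => ih ρ hρ m'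
  -- the coefficient of `x ^ m` of the partial sums is constant from `cut m` on
  let cut : ℤ → ℕ := fun m => (m - m₀ + 1).toNat
  obtain ⟨y, hy⟩ := exists_cf_eq
    (fun ρ m => cf ρ m (∑ i ∈ Finset.range (cut m), N^[i] g)) s m₀ (fun ρ m h => by
      constructor
      · by_contra hρ
        exact h (by rw [map_sum]; exact Finset.sum_eq_zero fun i _ => hsupp i ρ hρ m)
      · by_contra hm
        refine h ?_
        rw [show cut m = 0 by simp only [cut]; omega]
        simp)
  have hstable : ∀ ρ m (n : ℕ), m < m₀ + n →
      cf ρ m y = cf ρ m (∑ i ∈ Finset.range n, N^[i] g) := fun ρ m n hmn => by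
    have hle : cut m ≤ n := by simp only [cut]; omega
    rw [hy, ← Finset.sum_range_add_sum_Ico _ hle, map_add, left_eq_add, map_sum]
    refine Finset.sum_eq_zero fun i hi => ?_
    refine hlow i ρ m ?_
    have := (Finset.mem_Ico.1 hi).1
    simp only [cut] at this
    omega
  refine ⟨y, cf_ext fun ρ m => ?_, fun ρ m => ⟨cut m, hy ρ m⟩⟩
  set n := cut m with hn
  have hmn : m < m₀ + n := by simp only [hn, cut]; omega
  set S := ∑ i ∈ Finset.range n, N^[i] g with hS
  have h1 : cf ρ m (N (y - S)) = 0 := hN _ ρ m fun m' hm' => by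
    rw [map_sub, hstable ρ m' n (by omega), sub_self]
  have h2 : S - N S = g - N^[n] g := by
    rw [hS, map_sum, ← Finset.sum_sub_distrib]
    simp_rw [← Function.iterate_succ_apply' N]
    exact Finset.sum_range_sub' (fun i => N^[i] g) n
  have h3 : cf ρ m (N y) = cf ρ m (N S) := by
    rw [map_sub, map_sub, sub_eq_zero] at h1
    exact h1
  rw [map_sub, hstable ρ m n hmn, h3, ← map_sub, h2, map_sub, hlow n ρ m hmn, sub_zero]

end Geometric

namespace DiffOp

variable {k : Type*} [Field k]

/-! ### The right inverse of the initial form on all of `R` -/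

/-- `L` as a linear map over the constants. -/
def actLin (L : DiffOp k) : EPC k →ₗ[constants k] EPC k where
  toFun := L.act
  map_add' := L.act_add
  map_smul' c y := L.act_const_mul c.2 y

theorem actInitial_eq (L : DiffOp k) (y : EPC k) :
    L.actInitial y = L.normalize.initialForm.actLin y := rfl

/-- `T = L₀ - M` as a linear map over the constants. -/
def actTLin (L : DiffOp k) : EPC k →ₗ[constants k] EPC k :=
  L.normalize.initialForm.actLin - L.normalize.actLin

theorem cf_actT_eq_zero {L : DiffOp k} (hL : L ≠ 0) {y : EPC k} {ρ : k} {m : ℤ}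
    (hy : ∀ m' < m, cf ρ m' y = 0) : cf ρ m (L.actT y) = 0 := by
  have h := cf_actT_mem hL (W := fun n => if n < m then ⊥ else ⊤)
    (fun a b hab => by
      dsimp only
      split_ifs <;> first | exact le_top | exact bot_le | (exfalso; omega))
    (fun n => by
      split_ifs
      · exact bot_le
      · rw [Submodule.comap_top])
    (y := y) (ρ := ρ) (fun n => by
      split_ifs with hn
      · exact (Submodule.mem_bot k).2 (hy n hn)
      · trivial) m
  rwa [if_pos (by omega), Submodule.mem_bot] at h

variable {p : ℕ} [Fact p.Prime] [CharP k p]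

/-- The complement of the kernel of `L₀` in `R`. -/
def complement (p : ℕ) [Fact p.Prime] [CharP k p] (L : DiffOp k) :
    Submodule (constants k) (EPC k) where
  carrier := {y | ∀ (ρ : k) (m : ℤ), cf ρ m y ∈ wUpper p k (L.mult (ρ + m))}
  zero_mem' ρ m := by rw [map_zero]; exact zero_mem _
  add_mem' hy hw ρ m := by rw [map_add]; exact add_mem (hy ρ m) (hw ρ m)
  smul_mem' c y hy σ n := by
    refine cf_mul_mem (c : EPC k) y σ n (wUpper p k (L.mult (σ + n))).toAddSubmonoid
      fun ρ i => ?_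
    change _ ∈ wUpper p k (L.mult (σ + n))
    obtain ⟨h1, h2⟩ := (mem_constants_iff p).1 c.2 ρ i
    by_cases h : ρ + (i : k) = 0
    · have h3 := hy (σ - ρ) (n - i)
      rw [show σ - ρ + ((n - i : ℤ) : k) = σ + n - (ρ + i) by push_cast; ring, h, sub_zero] at h3
      exact Submodule.smul_mem _ (⟨_, h1⟩ : zConst k) h3
    · rw [h2 h, zero_mul]; exact zero_mem _

theorem eq_of_cf_actInitial_eq {L : DiffOp k} (hL : L.IsRegularSingular) {ρ : k} {m : ℤ}
    {y : EPC k} (hy : y ∈ L.complement p) {f : RatZ k} (hf : f ∈ wUpper p k (L.mult (ρ + m)))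
    (h : Polynomial.aeval (zD k (ρ + m)) L.indicial f = cf ρ m (L.actInitial y)) :
    f = cf ρ m y := by
  rw [cf_actInitial hL.1] at h
  exact aeval_zD_injOn_wUpper hL.natDegree_indicial.2 (ρ + m) hf (hy ρ m) h

theorem bijective_actInitial_complement (p : ℕ) [Fact p.Prime] [CharP k p] {L : DiffOp k}
    (hL : L.IsRegularSingular) :
    Function.Bijective (L.normalize.initialForm.actLin.domRestrict (L.complement p)) := by
  constructor
  · rintro ⟨y, hy⟩ ⟨w, hw⟩ h
    refine Subtype.ext (cf_ext fun ρ m => ?_)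
    refine eq_of_cf_actInitial_eq hL hw (hy ρ m) ?_
    rw [← cf_actInitial hL.1]
    exact congrArg (cf ρ m) h
  · intro g
    choose F hF hFg using fun (ρ : k) (m : ℤ) =>
      exists_mem_wUpper_aeval_zD_eq (p := p) hL.natDegree_indicial.2 (ρ + m) (cf ρ m g)
    obtain ⟨s, m₀, hb⟩ := exists_cf_bound g
    obtain ⟨y, hy⟩ := exists_cf_eq F s m₀ fun ρ m h => hb ρ m fun h0 => h (by
      refine aeval_zD_injOn_wUpper hL.natDegree_indicial.2 (ρ + m) (hF ρ m) (zero_mem _) ?_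
      rw [hFg, h0, map_zero])
    refine ⟨⟨y, fun ρ m => by rw [hy]; exact hF ρ m⟩, cf_ext fun ρ m => ?_⟩
    change cf ρ m (L.actInitial y) = _
    rw [cf_actInitial hL.1, hy, hFg]

/-- The right inverse of `L₀` on `R` with values in `complement p L`. -/
def sectionLin (p : ℕ) [Fact p.Prime] [CharP k p] (L : DiffOp k) (hL : L.IsRegularSingular) :
    EPC k →ₗ[constants k] EPC k :=
  (L.complement p).subtype ∘ₗ
    (LinearEquiv.ofBijective _ (bijective_actInitial_complement p hL)).symm.toLinearMap

variable {L : DiffOp k} (hL : L.IsRegularSingular)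

theorem sectionLin_mem (y : EPC k) : L.sectionLin p hL y ∈ L.complement p := Subtype.mem _

theorem actInitial_sectionLin (y : EPC k) : L.actInitial (L.sectionLin p hL y) = y :=
  (LinearEquiv.ofBijective _ (bijective_actInitial_complement p hL)).apply_symm_apply y

/-- A coefficient of `S y` is determined by the same coefficient of `y`. -/
theorem cf_sectionLin_eq {ρ : k} {m : ℤ} {y : EPC k} {f : RatZ k}
    (hf : f ∈ wUpper p k (L.mult (ρ + m)))
    (h : Polynomial.aeval (zD k (ρ + m)) L.indicial f = cf ρ m y) :
    cf ρ m (L.sectionLin p hL y) = f :=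
  (eq_of_cf_actInitial_eq hL (sectionLin_mem hL y) hf
    (by rw [h, actInitial_sectionLin])).symm

theorem cf_sectionLin_eq_zero {ρ : k} {m : ℤ} {y : EPC k} (h : cf ρ m y = 0) :
    cf ρ m (L.sectionLin p hL y) = 0 :=
  cf_sectionLin_eq hL (zero_mem _) (by rw [h, map_zero])

theorem cf_sectionLin_actT_eq_zero (y : EPC k) (ρ : k) (m : ℤ) (hy : ∀ m' < m, cf ρ m' y = 0) :
    cf ρ m ((L.sectionLin p hL ∘ₗ L.actTLin).toAddMonoidHom y) = 0 :=
  cf_sectionLin_eq_zero hL (cf_actT_eq_zero hL.1 hy)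

theorem bijective_id_sub (p : ℕ) [Fact p.Prime] [CharP k p] {L : DiffOp k}
    (hL : L.IsRegularSingular) :
    Function.Bijective (LinearMap.id - L.sectionLin p hL ∘ₗ L.actTLin :
      EPC k →ₗ[constants k] EPC k) := by
  constructor
  · rw [← LinearMap.ker_eq_bot, LinearMap.ker_eq_bot']
    exact fun y hy => eq_zero_of_eq_apply (cf_sectionLin_actT_eq_zero hL) (sub_eq_zero.1 hy)
  · intro g
    obtain ⟨y, hy, -⟩ := exists_sub_apply_eq (cf_sectionLin_actT_eq_zero (p := p) hL) g
    exact ⟨y, hy⟩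

/-- The automorphism `u = Id - S ∘ T` of `R`. -/
def autLin (p : ℕ) [Fact p.Prime] [CharP k p] (L : DiffOp k) (hL : L.IsRegularSingular) :
    EPC k ≃ₗ[constants k] EPC k :=
  LinearEquiv.ofBijective _ (bijective_id_sub p hL)

theorem autLin_apply (y : EPC k) :
    L.autLin p hL y = y - L.sectionLin p hL (L.actT y) := rfl

/-- `L₀ ∘ u = M`. -/
theorem actInitial_autLin (y : EPC k) : L.actInitial (L.autLin p hL y) = L.normalize.act y := by
  rw [autLin_apply, actInitial_eq, map_sub, ← actInitial_eq, ← actInitial_eq,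
    actInitial_sectionLin, actT, sub_sub_cancel]

theorem mem_solutions_iff (y : EPC k) :
    y ∈ L.solutions ↔ L.actInitial (L.autLin p hL y) = 0 := by
  rw [actInitial_autLin]
  exact L.act_eq_zero_iff y

end DiffOp

/-! ### The function spaces -/

section FunctionSpaces

variable {k : Type*} [Field k]

/-- The elements `t^ρ ∑ f_m x^m` of `R` with `f_m ∈ W m`. -/
def component (ρ : k) (W : ℤ → Submodule k (RatZ k)) : AddSubgroup (EPC k) where
  carrier := {y | (∀ σ, σ ≠ ρ → ∀ m, cf σ m y = 0) ∧ ∀ m, cf ρ m y ∈ W m}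
  zero_mem' := ⟨fun σ _ m => map_zero _, fun m => by rw [map_zero]; exact zero_mem _⟩
  add_mem' hy hw := ⟨fun σ h m => by rw [map_add, hy.1 σ h, hw.1 σ h, add_zero],
    fun m => by rw [map_add]; exact add_mem (hy.2 m) (hw.2 m)⟩
  neg_mem' hy := ⟨fun σ h m => by rw [map_neg, hy.1 σ h, neg_zero],
    fun m => by rw [map_neg]; exact neg_mem (hy.2 m)⟩

theorem mem_component {ρ : k} {W : ℤ → Submodule k (RatZ k)} {y : EPC k} :
    y ∈ component ρ W ↔ (∀ σ, σ ≠ ρ → ∀ m, cf σ m y = 0) ∧ ∀ m, cf ρ m y ∈ W m := Iff.rfl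

theorem component_mono {ρ : k} {W W' : ℤ → Submodule k (RatZ k)} (h : ∀ m, W m ≤ W' m) :
    component ρ W ≤ component ρ W' := fun _ hy => ⟨hy.1, fun m => h m (hy.2 m)⟩

theorem seriesSpace_eq_component {ρ : k} {A : ℕ → Set (ℕ →₀ ℕ)} {W : ℤ → Submodule k (RatZ k)}
    (h0 : ∀ m < 0, W m = ⊥) (hW : ∀ m : ℕ, W m = Submodule.span k (zMon k '' A m)) :
    seriesSpace ρ A = component ρ W := by
  ext y
  rw [SetLike.mem_coe, mem_component]
  constructor
  · rintro ⟨f, rfl, h1, h2⟩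
    refine ⟨fun σ hσ m => cf_tMul_of_ne hσ.symm _ _, fun m => ?_⟩
    rw [cf_tMul_self]
    rcases lt_or_ge m 0 with hm | hm
    · rw [h1 m hm]; exact zero_mem _
    · lift m to ℕ using hm
      rw [hW]
      exact h2 m
  · rintro ⟨h1, h2⟩
    refine ⟨AddMonoidAlgebra.coeff (R := LaurentSeries (RatZ k)) (M := k) y ρ,
      cf_ext fun σ m => ?_, fun m hm => ?_, fun m => ?_⟩
    · by_cases hσ : σ = ρ
      · subst hσ; rw [cf_tMul_self]; rfl
      · rw [h1 σ hσ, cf_tMul_of_ne (Ne.symm hσ)]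
    · have h3 := h2 m
      rw [h0 m hm] at h3
      exact (Submodule.mem_bot k).1 h3
    · rw [← hW]
      exact h2 m

namespace DiffOp

/-- The number `ξ(m)`, extended by zero to negative `m`. -/
def xiInt (L : DiffOp k) (ρ : k) (m : ℤ) : ℕ :=
  ∑ i ∈ Finset.range (m + 1).toNat, L.mult (ρ + i)

theorem xiInt_of_neg (L : DiffOp k) (ρ : k) {m : ℤ} (hm : m < 0) : L.xiInt ρ m = 0 := by
  rw [xiInt, show (m + 1).toNat = 0 by omega, Finset.sum_range_zero]

theorem xiInt_natCast (L : DiffOp k) (ρ : k) (m : ℕ) : L.xiInt ρ m = L.xi ρ m := by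
  rw [xiInt, xi, show ((m : ℤ) + 1).toNat = m + 1 by omega]

theorem xiInt_mono (L : DiffOp k) (ρ : k) : Monotone (L.xiInt ρ) := fun a b hab =>
  Finset.sum_le_sum_of_subset (Finset.range_mono (by omega))

theorem xiInt_eq_add (L : DiffOp k) (ρ : k) {m : ℤ} (hm : 0 ≤ m) :
    L.xiInt ρ m = L.xiInt ρ (m - 1) + L.mult (ρ + m) := by
  lift m to ℕ using hm
  rw [xiInt, xiInt, show ((m : ℤ) + 1).toNat = m + 1 by omega,
    show ((m : ℤ) - 1 + 1).toNat = m by omega, Finset.sum_range_succ, Int.cast_natCast]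

theorem functionSpace_eq (p : ℕ) (L : DiffOp k) (ρ : k) :
    L.functionSpace p ρ = component ρ fun m => chainSpan p k (L.xiInt ρ m) :=
  seriesSpace_eq_component
    (fun m hm => by rw [xiInt_of_neg L ρ hm, chainSpan_zero])
    (fun m => by rw [xiInt_natCast]; rfl)

theorem functionSpaceX_eq (p : ℕ) (L : DiffOp k) (ρ : k) :
    L.functionSpaceX p ρ = component ρ fun m => chainSpan p k (L.xiInt ρ (m - 1)) := by
  ext y
  rw [functionSpaceX, functionSpace_eq, SetLike.mem_coe, mem_component]
  constructor
  · rintro ⟨w, ⟨h1, h2⟩, rfl⟩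
    dsimp only
    refine ⟨fun σ hσ m => ?_, fun m => ?_⟩
    · rw [mul_comm, cf_xPow_mul, h1 σ hσ]
    · rw [mul_comm, cf_xPow_mul]
      exact h2 (m - 1)
  · rintro ⟨h1, h2⟩
    refine ⟨xPow k (-1) * y, ⟨fun σ hσ m => ?_, fun m => ?_⟩, cf_ext fun σ m => ?_⟩
    · rw [cf_xPow_mul, h1 σ hσ]
    · have h3 := h2 (m - -1)
      rw [sub_neg_eq_add, add_sub_cancel_right] at h3
      rw [cf_xPow_mul, sub_neg_eq_add]
      exact h3
    · dsimp only
      rw [mul_comm, cf_xPow_mul, cf_xPow_mul, sub_neg_eq_add, sub_add_cancel]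

theorem complementSpace_eq (p : ℕ) (L : DiffOp k) (ρ : k) : L.complementSpace p ρ =
    component ρ fun m => chainUpper p k (L.xiInt ρ m) (L.mult (ρ + m)) :=
  seriesSpace_eq_component
    (fun m hm => by
      rw [eq_bot_iff]
      refine (chainUpper_le _ _).trans ?_
      rw [xiInt_of_neg L ρ hm, chainSpan_zero])
    (fun m => by rw [xiInt_natCast, Int.cast_natCast]; rfl)

theorem complementSpace_subset_functionSpace (p : ℕ) (L : DiffOp k) (ρ : k) :
    L.complementSpace p ρ ⊆ L.functionSpace p ρ := by
  rw [complementSpace_eq, functionSpace_eq]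
  exact component_mono fun m => chainUpper_le _ _

theorem tzMon_floorSeq_mem {p : ℕ} [Fact p.Prime] {L : DiffOp k} {ρ : k} {i : ℕ}
    (hi : i < L.mult ρ) :
    tzMon ρ (floorSeq p i) ∈ L.functionSpace p ρ := by
  refine ⟨_, rfl, fun m hm => ?_, fun m => ?_⟩
  · rw [HahnSeries.C_apply, HahnSeries.coeff_single_of_ne (by omega)]
  · rw [HahnSeries.C_apply]
    rcases Nat.eq_zero_or_pos m with rfl | hm
    · rw [Nat.cast_zero, HahnSeries.coeff_single_same]
      refine Submodule.subset_span ⟨_, ⟨?_, isFloorChain_floorSeq i⟩, rfl⟩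
      simpa [xi, floorSeq_apply] using hi
    · rw [HahnSeries.coeff_single_of_ne (by omega)]
      exact zero_mem _

variable {p : ℕ} [Fact p.Prime] [CharP k p] {L : DiffOp k} (hL : L.IsRegularSingular) {ρ : k}

theorem complementSpace_subset_complement : L.complementSpace p ρ ⊆ L.complement p := by
  rw [complementSpace_eq]
  rintro y ⟨h1, h2⟩ σ m
  by_cases hσ : σ = ρ
  · subst hσ
    exact chainUpper_le_wUpper _ _ (h2 m)
  · rw [h1 σ hσ]; exact zero_mem _

/-- On `F x` the operator `S` takes values in `H`: the preimages in the span of floor chains lie in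
the complement of the kernel, where preimages are unique. -/
theorem sectionLin_mapsTo :
    Set.MapsTo (L.sectionLin p hL) (L.functionSpaceX p ρ) (L.complementSpace p ρ) := by
  rw [complementSpace_eq, functionSpaceX_eq]
  rintro y ⟨h1, h2⟩
  refine ⟨fun σ hσ m => cf_sectionLin_eq_zero hL (h1 σ hσ m), fun m => ?_⟩
  rcases lt_or_ge m 0 with hm | hm
  · have h3 : cf ρ m y ∈ chainSpan p k (L.xiInt ρ (m - 1)) := h2 m
    rw [xiInt_of_neg L ρ (by omega : m - 1 < 0), chainSpan_zero, Submodule.mem_bot] at h3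
    rw [cf_sectionLin_eq_zero hL h3]
    exact zero_mem _
  · obtain ⟨f, hf, hfy⟩ :=
      exists_mem_chainUpper_aeval_zD_eq hL.natDegree_indicial.2 (ρ + m) (h2 m)
    rw [cf_sectionLin_eq hL (chainUpper_le_wUpper _ _ hf) hfy]
    dsimp only
    rw [xiInt_eq_add L ρ hm]
    exact hf

theorem actInitial_bijOn (p : ℕ) [Fact p.Prime] [CharP k p] {L : DiffOp k}
    (hL : L.IsRegularSingular) (ρ : k) :
    Set.BijOn L.actInitial (L.complementSpace p ρ) (L.functionSpaceX p ρ) := by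
  refine ⟨?_, fun y hy w hw h => cf_ext fun σ m => ?_, fun g hg =>
    ⟨_, sectionLin_mapsTo (p := p) hL hg, actInitial_sectionLin hL g⟩⟩
  · rw [complementSpace_eq, functionSpaceX_eq]
    rintro y ⟨h1, h2⟩
    refine ⟨fun σ hσ m => ?_, fun m => ?_⟩
    · rw [cf_actInitial hL.1, h1 σ hσ, map_zero]
    · rw [cf_actInitial hL.1]
      have h3 := chainUpper_le _ _ (h2 m)
      rcases lt_or_ge m 0 with hm | hm
      · rw [xiInt_of_neg L ρ hm, chainSpan_zero, Submodule.mem_bot] at h3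
        rw [h3, map_zero]
        exact zero_mem _
      · rw [xiInt_eq_add L ρ hm] at h3
        exact aeval_zD_mem_chainSpan hL.natDegree_indicial.2 (ρ + m) h3
  · refine eq_of_cf_actInitial_eq (p := p) hL (complementSpace_subset_complement hw)
      (complementSpace_subset_complement hy σ m) ?_
    rw [← cf_actInitial hL.1, h]

theorem rightInv_eq {y : EPC k} (hy : y ∈ L.functionSpaceX p ρ) :
    L.rightInv p ρ y = L.sectionLin p hL y := by
  have hb := actInitial_bijOn p hL ρ
  refine hb.injOn (Function.invFunOn_mem (hb.surjOn hy)) (sectionLin_mapsTo hL hy) ?_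
  rw [actInitial_sectionLin]
  exact Function.invFunOn_eq (hb.surjOn hy)

theorem actT_mapsTo (p : ℕ) [Fact p.Prime] [CharP k p] {L : DiffOp k}
    (hL : L.IsRegularSingular) (ρ : k) :
    Set.MapsTo L.actT (L.functionSpace p ρ) (L.functionSpaceX p ρ) := by
  rw [functionSpace_eq, functionSpaceX_eq]
  rintro y ⟨h1, h2⟩
  refine ⟨fun σ hσ m => cf_actT_eq_zero hL.1 fun m' _ => h1 σ hσ m', ?_⟩
  exact cf_actT_mem hL.1 (W := fun m => chainSpan p k (L.xiInt ρ m))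
    (fun a b hab => chainSpan_mono (xiInt_mono L ρ hab)) (fun m => chainSpan_le_comap _) h2

theorem autU_eq {y : EPC k} (hy : y ∈ L.functionSpace p ρ) :
    L.autU p ρ y = L.autLin p hL y := by
  rw [autU, rightInv_eq hL (actT_mapsTo p hL ρ hy), autLin_apply]

theorem autU_bijOn (p : ℕ) [Fact p.Prime] [CharP k p] {L : DiffOp k}
    (hL : L.IsRegularSingular) (ρ : k) :
    Set.BijOn (L.autU p ρ) (L.functionSpace p ρ) (L.functionSpace p ρ) := by
  have hN : Set.MapsTo (L.sectionLin p hL ∘ₗ L.actTLin).toAddMonoidHom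
      (L.functionSpace p ρ) (L.functionSpace p ρ) := fun y hy =>
    complementSpace_subset_functionSpace p L ρ (sectionLin_mapsTo hL (actT_mapsTo p hL ρ hy))
  refine ⟨fun y hy => ?_, fun y hy w hw h => ?_, fun g hg => ?_⟩
  · rw [autU_eq hL hy, autLin_apply]
    have h := hN hy
    rw [functionSpace_eq] at hy h ⊢
    exact sub_mem hy h
  · rw [autU_eq hL hy, autU_eq hL hw] at h
    exact (L.autLin p hL).injective h
  · obtain ⟨y, hy, hsum⟩ := exists_sub_apply_eq (cf_sectionLin_actT_eq_zero (p := p) hL) g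
    have hF : y ∈ L.functionSpace p ρ := by
      have hpart : ∀ n : ℕ, ∑ i ∈ Finset.range n,
          (L.sectionLin p hL ∘ₗ L.actTLin).toAddMonoidHom^[i] g ∈ L.functionSpace p ρ :=
        fun n => by
          have h := fun i => hN.iterate i hg
          rw [functionSpace_eq] at h ⊢
          exact sum_mem fun i _ => h i
      rw [functionSpace_eq] at hpart ⊢
      refine ⟨fun σ hσ m => ?_, fun m => ?_⟩
      · obtain ⟨n, hn⟩ := hsum σ m
        rw [hn]
        exact (hpart n).1 σ hσ m
      · obtain ⟨n, hn⟩ := hsum ρ m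
        rw [hn]
        exact (hpart n).2 m
    exact ⟨y, hF, (autU_eq hL hF).trans hy⟩

theorem autUInv_eq {y : EPC k} (hy : y ∈ L.functionSpace p ρ) :
    L.autUInv p ρ y = (L.autLin p hL).symm y := by
  have hs := (autU_bijOn p hL ρ).surjOn hy
  rw [LinearEquiv.eq_symm_apply, autUInv, ← autU_eq hL (Function.invFunOn_mem hs)]
  exact Function.invFunOn_eq hs

end DiffOp

end FunctionSpaces

/-! ### The basis of the space of solutions -/

namespace DiffOp

variable {k : Type*} [Field k]

theorem isLocalExponent_of_lt_mult {L : DiffOp k} {ρ : k} {i : ℕ} (h : i < L.mult ρ) :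
    L.IsLocalExponent ρ := by
  by_contra h0
  rw [mult, Polynomial.rootMultiplicity_eq_zero h0] at h
  exact Nat.not_lt_zero _ h

theorem finite_isLocalExponent {L : DiffOp k} (hL : L.IsRegularSingular) :
    Finite {ρ : k // L.IsLocalExponent ρ} :=
  Set.Finite.to_subtype (Polynomial.finite_setOfPred_isRoot hL.natDegree_indicial.2)

/-- Over an algebraically closed field the multiplicities of the local exponents add up to the
order. -/
theorem card_sigma_mult [IsAlgClosed k] {L : DiffOp k} (hL : L.IsRegularSingular) :
    Nat.card (Σ ρ : {ρ : k // L.IsLocalExponent ρ}, Fin (L.mult ρ.1)) = L.order := by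
  classical
  obtain ⟨hdeg, h0⟩ := hL.natDegree_indicial
  have := finite_isLocalExponent hL
  have := Fintype.ofFinite {ρ : k // L.IsLocalExponent ρ}
  rw [Nat.card_eq_fintype_card, Fintype.card_sigma]
  simp only [Fintype.card_fin]
  rw [← hdeg, (IsAlgClosed.splits L.indicial).natDegree_eq_card_roots,
    ← Multiset.toFinset_sum_count_eq]
  simp only [Polynomial.count_roots]
  refine (Finset.sum_subtype L.indicial.roots.toFinset (fun ρ => ?_) _).symm
  rw [Multiset.mem_toFinset, Polynomial.mem_roots h0]
  rfl

theorem cf_constant_mul_tzMon {p : ℕ} [Fact p.Prime] (c : EPC k) (σ ρ : k) (m : ℤ) (i : ℕ) :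
    cf σ m (c * tzMon ρ (floorSeq p i)) = cf (σ - ρ) m c * wMon p k i := by
  rw [mul_comm, tzMon, cf_tMul_mul σ ρ m _ 0 _ (HahnSeries.C_apply _), sub_zero, mul_comm]
  rfl

variable {p : ℕ} [Fact p.Prime] [CharP k p]

theorem coord_mul_wMon {a : RatZ k} (ha : a ∈ zConst k) (e i : ℕ) :
    ((wBasis p k).coord e (a * wMon p k i) : RatZ k) = if i = e then a else 0 := by
  rw [← wBasis_apply]
  have h : a * wBasis p k i = (⟨a, ha⟩ : zConst k) • wBasis p k i := rfl
  rw [h, map_smul, Module.Basis.coord_apply, Module.Basis.repr_self, Finsupp.single_apply]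
  split_ifs <;> simp

/-- The coefficient of `t^σ x^m` in a combination `∑ c_{ρ,i} t^ρ z^{i^*}` with constant `c_{ρ,i}`
involves the terms with `ρ = σ + m` only. -/
theorem coord_cf_sum {L : DiffOp k}
    (s : Finset (Σ ρ : {ρ : k // L.IsLocalExponent ρ}, Fin (L.mult ρ.1)))
    (c : (Σ ρ : {ρ : k // L.IsLocalExponent ρ}, Fin (L.mult ρ.1)) → constants k)
    (σ : k) (m : ℤ) (e : ℕ) :
    ((wBasis p k).coord e
      (cf σ m (∑ x ∈ s, c x • tzMon x.1.1 (floorSeq p (x.2 : ℕ)))) : RatZ k) =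
      ∑ x ∈ s, if (x.2 : ℕ) = e then cf (σ - x.1.1) m (c x : EPC k) else 0 := by
  rw [map_sum, map_sum, AddSubmonoidClass.coe_finsetSum]
  refine Finset.sum_congr rfl fun x _ => ?_
  rw [← coord_mul_wMon ((mem_constants_iff p).1 (c x).2 (σ - x.1.1) m).1,
    ← cf_constant_mul_tzMon]
  rfl

theorem linearIndependent_tzMon (p : ℕ) [Fact p.Prime] [CharP k p] (L : DiffOp k) :
    LinearIndependent (constants k)
      fun x : (Σ ρ : {ρ : k // L.IsLocalExponent ρ}, Fin (L.mult ρ.1)) =>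
        tzMon x.1.1 (floorSeq p (x.2 : ℕ)) := by
  rw [linearIndependent_iff']
  rintro s c hsum ⟨⟨ρ, hρ⟩, i⟩ hx
  refine Subtype.ext (cf_ext fun τ m => ?_)
  change cf τ m (c ⟨⟨ρ, hρ⟩, i⟩ : EPC k) = cf τ m 0
  rw [map_zero]
  by_cases hτ : τ + (m : k) = 0
  · have h := coord_cf_sum (p := p) s c (ρ + τ) m i
    rw [hsum, map_zero, map_zero, ZeroMemClass.coe_zero, Finset.sum_eq_single _ _
      (fun h => absurd hx h), if_pos rfl, add_sub_cancel_left] at h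
    · exact h.symm
    · rintro ⟨⟨ρ', hρ'⟩, i'⟩ _ hne
      split_ifs with hi
      · refine ((mem_constants_iff p).1 (c _).2 _ m).2 fun h0 => hne ?_
        have h1 : ρ' = ρ := by
          have h2 : ρ + τ - ρ' + (m : k) = 0 := h0
          linear_combination hτ - h2
        subst h1
        exact congrArg _ (Fin.ext hi)
      · rfl
  · exact ((mem_constants_iff p).1 (c _).2 τ m).2 hτ

/-- The elements `t^ρ z^{i^*}`, `i < m_ρ`, span the kernel of `L₀` over the constants. -/
theorem mem_span_tzMon_iff (p : ℕ) [Fact p.Prime] [CharP k p] {L : DiffOp k}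
    (hL : L.IsRegularSingular) (y : EPC k) :
    y ∈ Submodule.span (constants k) (Set.range
      fun x : (Σ ρ : {ρ : k // L.IsLocalExponent ρ}, Fin (L.mult ρ.1)) =>
        tzMon x.1.1 (floorSeq p (x.2 : ℕ))) ↔ L.actInitial y = 0 := by
  have hker : L.actInitial y = 0 ↔ ∀ σ (m : ℤ) e, L.mult (σ + m) ≤ e →
      (wBasis p k).coord e (cf σ m y) = 0 := by
    have h1 : L.actInitial y = 0 ↔ ∀ σ (m : ℤ), cf σ m (L.actInitial y) = 0 :=
      ⟨fun h σ m => by rw [h, map_zero], fun h => cf_ext fun σ m => by rw [h, map_zero]⟩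
    rw [h1]
    refine forall₂_congr fun σ m => ?_
    rw [cf_actInitial hL.1, aeval_zD_eq_zero_iff p hL.natDegree_indicial.2,
      zD_pow_eq_zero_iff (p := p)]
    rfl
  constructor
  · have hle : Submodule.span (constants k) (Set.range
        fun x : (Σ ρ : {ρ : k // L.IsLocalExponent ρ}, Fin (L.mult ρ.1)) =>
          tzMon x.1.1 (floorSeq p (x.2 : ℕ))) ≤
        LinearMap.ker L.normalize.initialForm.actLin := by
      refine Submodule.span_le.2 ?_
      rintro _ ⟨⟨⟨ρ, hρ⟩, i⟩, rfl⟩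
      refine cf_ext fun σ m => ?_
      change cf σ m (L.actInitial (tMul ρ (HahnSeries.C (zMon k (floorSeq p (i : ℕ)))))) = _
      rw [map_zero, cf_actInitial hL.1, aeval_zD_eq_zero_iff p hL.natDegree_indicial.2]
      by_cases hσ : ρ = σ
      · subst hσ
        rw [cf_tMul_self, HahnSeries.C_apply]
        by_cases hm : m = 0
        · subst hm
          rw [HahnSeries.coeff_single_same, Int.cast_zero, add_zero]
          exact zD_pow_wMon_of_lt i.2
        · rw [HahnSeries.coeff_single_of_ne hm, map_zero]
      · rw [cf_tMul_of_ne hσ, map_zero]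
    exact fun h => hle h
  · intro hy
    rw [hker] at hy
    have := finite_isLocalExponent hL
    have := Fintype.ofFinite {ρ : k // L.IsLocalExponent ρ}
    classical
    -- the coefficient of `t^ρ z^{i^*}` collects the terms `t^σ x^m` of `y` with `σ + m = ρ`
    have hc : ∀ x : (Σ ρ : {ρ : k // L.IsLocalExponent ρ}, Fin (L.mult ρ.1)),
        ∃ c : constants k, ∀ τ (m : ℤ), cf τ m (c : EPC k) =
          if τ + (m : k) = 0 then
            ((wBasis p k).coord x.2 (cf (x.1.1 + τ) m y) : RatZ k) else 0 := fun x => by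
      obtain ⟨s, m₀, hb⟩ := exists_cf_bound y
      obtain ⟨c, hc⟩ := exists_cf_eq (fun τ (m : ℤ) => if τ + (m : k) = 0 then
          ((wBasis p k).coord x.2 (cf (x.1.1 + τ) m y) : RatZ k) else 0)
        (s.image fun σ => σ - x.1.1) m₀ (fun τ m h => by
          have h1 : cf (x.1.1 + τ) m y ≠ 0 := fun h0 => h (by
            rw [h0, map_zero]
            simp)
          obtain ⟨h2, h3⟩ := hb _ _ h1
          exact ⟨Finset.mem_image.2 ⟨_, h2, by ring⟩, h3⟩)
      refine ⟨⟨c, (mem_constants_iff p).2 fun τ m => ?_⟩, hc⟩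
      rw [hc]
      split_ifs with h
      · exact ⟨Subtype.mem _, fun h' => absurd h h'⟩
      · exact ⟨zero_mem _, fun _ => rfl⟩
    choose c hc using hc
    have hsum : y = ∑ x, c x • tzMon x.1.1 (floorSeq p (x.2 : ℕ)) := by
      refine cf_ext fun σ m => (wBasis p k).ext_elem fun e => Subtype.ext ?_
      rw [← Module.Basis.coord_apply, ← Module.Basis.coord_apply, coord_cf_sum]
      have hterm : ∀ x : (Σ ρ : {ρ : k // L.IsLocalExponent ρ}, Fin (L.mult ρ.1)),
          (if (x.2 : ℕ) = e then cf (σ - x.1.1) m (c x : EPC k) else 0) =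
            if (x.2 : ℕ) = e ∧ x.1.1 = σ + m then
              ((wBasis p k).coord e (cf σ m y) : RatZ k) else 0 := fun x => by
        by_cases hi : (x.2 : ℕ) = e
        · rw [if_pos hi, hc, add_sub_cancel, hi]
          refine if_congr ?_ rfl rfl
          constructor
          · exact fun h => ⟨rfl, by linear_combination -h⟩
          · exact fun h => by rw [h.2]; ring
        · rw [if_neg hi, if_neg fun h => hi h.1]
      rw [Finset.sum_congr rfl fun x _ => hterm x]
      rcases lt_or_ge e (L.mult (σ + m)) with he | he
      · rw [Finset.sum_eq_single ⟨⟨σ + m, isLocalExponent_of_lt_mult he⟩, ⟨e, he⟩⟩,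
          if_pos ⟨rfl, rfl⟩]
        · rintro ⟨⟨ρ', hρ'⟩, i'⟩ _ hne
          refine if_neg ?_
          rintro ⟨hi, hρ⟩
          dsimp only at hi hρ
          subst hρ
          exact hne (congrArg _ (Fin.ext hi))
        · exact fun h => absurd (Finset.mem_univ _) h
      · rw [hy σ m e he, ZeroMemClass.coe_zero]
        exact (Finset.sum_eq_zero fun x _ => ite_self _).symm
    rw [hsum]
    exact Submodule.sum_mem _ fun x _ => Submodule.smul_mem _ _ (Submodule.subset_span ⟨x, rfl⟩)

/-- The inverse of `u` maps the basis `t^ρ z^{i^*}` of the kernel of `L₀` to a basis of the space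
of solutions. -/
theorem exists_basis_solutions (p : ℕ) [Fact p.Prime] [CharP k p] {L : DiffOp k}
    (hL : L.IsRegularSingular) :
    ∃ b : Module.Basis (Σ ρ : {ρ : k // L.IsLocalExponent ρ}, Fin (L.mult ρ.1))
      (constants k) L.solutions,
      ∀ x, (b x : EPC k) = (L.autLin p hL).symm (tzMon x.1.1 (floorSeq p (x.2 : ℕ))) := by
  have hli := (linearIndependent_tzMon p L).map' (L.autLin p hL).symm.toLinearMap
    (LinearEquiv.ker _)
  have hspan : Submodule.span (constants k) (Set.range ((L.autLin p hL).symm.toLinearMap ∘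
      fun x : (Σ ρ : {ρ : k // L.IsLocalExponent ρ}, Fin (L.mult ρ.1)) =>
        tzMon x.1.1 (floorSeq p (x.2 : ℕ)))) = L.solutions := by
    ext y
    rw [Set.range_comp, ← Submodule.map_span, mem_solutions_iff hL, ← mem_span_tzMon_iff p hL]
    exact Submodule.mem_map_equiv (e := (L.autLin p hL).symm) _
  refine ⟨(Module.Basis.span hli).map (LinearEquiv.ofEq _ _ hspan), fun x => ?_⟩
  rw [Module.Basis.map_apply, LinearEquiv.coe_ofEq_apply, Module.Basis.span_apply]
  rfl

end DiffOp

end EulerPrimitive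

end

theorem theorem3p12 {p : ℕ} [Fact p.Prime] {k : Type*} [Field k] [IsAlgClosed k] [CharP k p]
    (L : EulerPrimitive.DiffOp k) (hL : L.IsRegularSingular) :
    -- the constants form a field
    IsField (EulerPrimitive.constants k) ∧
    -- the maps `S` and `u_ρ` are well defined
    (∀ ρ : k, L.IsLocalExponent ρ →
      Set.BijOn L.actInitial (L.complementSpace p ρ) (L.functionSpaceX p ρ) ∧
      Set.MapsTo L.actT (L.functionSpace p ρ) (L.functionSpaceX p ρ) ∧
      Set.BijOn (L.autU p ρ) (L.functionSpace p ρ) (L.functionSpace p ρ) ∧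
      ∀ i < L.mult ρ,
        EulerPrimitive.tzMon ρ (EulerPrimitive.floorSeq p i) ∈ L.functionSpace p ρ) ∧
    -- the dimension and the basis of the space of solutions
    Module.finrank (EulerPrimitive.constants k) L.solutions = L.order ∧
    ∃ b : Module.Basis (Σ ρ : {ρ : k // L.IsLocalExponent ρ}, Fin (L.mult ρ.1))
        (EulerPrimitive.constants k) L.solutions,
      ∀ (ρ : {ρ : k // L.IsLocalExponent ρ}) (i : Fin (L.mult ρ.1)),
        (b ⟨ρ, i⟩ : EulerPrimitive.EPC k) =
          L.autUInv p ρ.1 (EulerPrimitive.tzMon ρ.1 (EulerPrimitive.floorSeq p i)) := by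
  obtain ⟨b, hb⟩ := EulerPrimitive.DiffOp.exists_basis_solutions p hL
  refine ⟨EulerPrimitive.isField_constants p, fun ρ _ =>
    ⟨EulerPrimitive.DiffOp.actInitial_bijOn p hL ρ, EulerPrimitive.DiffOp.actT_mapsTo p hL ρ,
      EulerPrimitive.DiffOp.autU_bijOn p hL ρ,
      fun i hi => EulerPrimitive.DiffOp.tzMon_floorSeq_mem hi⟩, ?_, b, fun ρ i => ?_⟩
  · rw [Module.finrank_eq_nat_card_basis b, EulerPrimitive.DiffOp.card_sigma_mult hL]
  · rw [hb, EulerPrimitive.DiffOp.autUInv_eq hL (EulerPrimitive.DiffOp.tzMon_floorSeq_mem i.2)]
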